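/- A \emph{complexon} is a function $W:\bigsqcup_{d\ge 1}[0,1]^{d+1}\to[0,1]$ whose restriction to each $[0,1]^{d+1}$ is Borel measurable and symmetric in its coordinates; by convention $W=1$ on the empty tuple and on tuples of length one. Its \emph{faceted complexon} is $\widehat W(x_1,\dots,x_{d+1})=\prod_{\sigma\subseteq[d+1]}W(x_\sigma)$, where $x_\sigma=(x_i)_{i\in\sigma}$. For $n\ge 1$, $\mathbb K(n,W)$ is the distribution of the following random simplicial complex on the vertex set $[n]=\{1,\dots,n\}$: draw $x_1,\dots,x_n$ independently and uniformly from $[0,1]$, include all vertices, and then, inductively for $d\ge 1$, include each $(d+1)$-element set $\sigma\subseteq[n]$ all of whose nonempty strict subsets have been included with probability $W(x_\sigma)$, using independent coin flips. A simplicial complex $K$ on $[n]$ is identified with the complexon $W_K$ that, for $d\ge1$, has the value $W_K(x_1,\dots,x_{d+1})=1$ if there are distinct $j_1,\dots,j_{d+1}\in[n]$ with $\{j_1,\dots,j_{d+1}\}\in K$ and $x_\ell\in[(j_\ell-1)/n,\,j_\ell/n)$ for all $\ell$, and $W_K(x_1,\dots,x_{d+1})=0$ otherwise. For complexons $U,V$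 and $j\ge1$ let $$d_{\square,j}(U,V)=\sup_{S_1,\dots,S_{j+1}}\left|\int_{S_1\times\cdots\times S_{j+1}}(U-V)\,dx\right|,$$ the supremum being over Borel sets $S_1,\dots,S_{j+1}\subseteq[0,1]$. For a finite sequence $\alpha_1,\dots,\alpha_d\ge 0$ let $$\delta_\square(U,V;(\alpha_j))=\inf_{\varphi}\sum_{j=1}^d\alpha_j\,d_{\square,j}(U,V^{\varphi}),\qquad V^\varphi(x_1,\dots,x_m)=V(\varphi(x_1),\dots,\varphi(x_m)),$$ the infimum being over all measure-preserving maps $\varphi:[0,1]\to[0,1]$. \textbf{Corollary.} Let $W$ be a complexon and let $\alpha_1,\dots,\alpha_d$ be a finite sequence of nonnegative real numbers. Let $(K_n)_{n\ge1}$ be random simplicial complexes defined on a common probability space, with arbitrary joint distribution, such that $K_n$ has distribution $\mathbb K(n,W)$ for every $n\ge 1$. Then, with probability $1$, $K_n$ converges to $\widehat W$ in the cut distance, i.e. $$\lim_{n\to\infty}\delta_\square\big(\widehat W,W_{K_n};(\alpha_j)\big)=0.$$ -/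

import Mathlib

open MeasureTheory ProbabilityTheory Filter Topology

/-- A complexon: a `[0,1]`-valued, totally symmetric, Borel measurable function of finite tuples of
points of `[0,1]`, with the convention that it takes the value `1` on tuples of length `0` and `1`.
The restriction to tuples of length `d + 1` is the `d`-dimensional part of the complexon. -/
structure Complexon where
  toFun : (m : ℕ) → (Fin m → unitInterval) → unitInterval
  measurable_toFun : ∀ m, Measurable (toFun m)
  symmetric : ∀ (m : ℕ) (π : Equiv.Perm (Fin m)) (x : Fin m → unitInterval),
    toFun m (x ∘ π) = toFun m x
  eq_one_of_le : ∀ (m : ℕ) (x : Fin m → unitInterval), m ≤ 1 → toFun m x = 1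

namespace Complexon

/-- `W(x_σ)`: the value of `W` at the coordinates of `x` indexed by `σ`. By symmetry the
(increasing) order in which they are listed is irrelevant. -/
noncomputable def onFace (W : Complexon) {n : ℕ} (x : Fin n → unitInterval)
    (σ : Finset (Fin n)) : unitInterval :=
  W.toFun σ.card (fun i => x (σ.orderEmbOfFin rfl i))

theorem toFun_comp_of_injective (W : Complexon) {m n : ℕ} (x : Fin n → unitInterval)
    (e : Fin m → Fin n) (he : Function.Injective e) (s : Finset (Fin n))
    (hs : Finset.univ.image e = s) : W.toFun m (x ∘ e) = W.onFace x s := by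
  have hc : s.card = m := by
    rw [← hs, Finset.card_image_of_injective _ he, Finset.card_univ, Fintype.card_fin]
  subst hc
  have hmem : ∀ i, e i ∈ s := fun i =>
    (Finset.ext_iff.mp hs (e i)).mp (Finset.mem_image_of_mem _ (Finset.mem_univ i))
  let p : Fin s.card → Fin s.card := fun i => (s.orderIsoOfFin rfl).symm ⟨e i, hmem i⟩
  have hp : Function.Injective p := by
    intro i j hij
    have := (s.orderIsoOfFin rfl).symm.injective hij
    exact he (congrArg Subtype.val this)
  let π : Equiv.Perm (Fin s.card) := Equiv.ofBijective p (Finite.injective_iff_bijective.mp hp)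
  have hπ : x ∘ e = (fun i => x (s.orderEmbOfFin rfl i)) ∘ π := by
    funext i
    simp [π, p, ← Finset.coe_orderIsoOfFin_apply]
  rw [hπ, W.symmetric]
  rfl

theorem onFace_comp_perm (W : Complexon) {n : ℕ} (π : Equiv.Perm (Fin n))
    (x : Fin n → unitInterval) (σ : Finset (Fin n)) :
    W.onFace (x ∘ π) σ = W.onFace x (σ.map π.toEmbedding) := by
  refine W.toFun_comp_of_injective x (fun i => π (σ.orderEmbOfFin rfl i))
    (π.injective.comp (σ.orderEmbOfFin rfl).injective) _ ?_
  ext a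
  have h := Finset.image_orderEmbOfFin_univ σ rfl
  constructor
  · intro ha
    obtain ⟨i, -, rfl⟩ := Finset.mem_image.mp ha
    exact Finset.mem_map.mpr ⟨_, Finset.orderEmbOfFin_mem σ rfl i, rfl⟩
  · intro ha
    obtain ⟨b, hb, rfl⟩ := Finset.mem_map.mp ha
    rw [← h] at hb
    obtain ⟨i, -, rfl⟩ := Finset.mem_image.mp hb
    exact Finset.mem_image.mpr ⟨i, Finset.mem_univ _, rfl⟩

theorem measurable_onFace (W : Complexon) {n : ℕ} (σ : Finset (Fin n)) :
    Measurable (fun x : Fin n → unitInterval => W.onFace x σ) :=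
  (W.measurable_toFun _).comp (measurable_pi_lambda _ fun _ => measurable_pi_apply _)

/-- The faceted complexon: its value at `(x_1, …, x_m)` is the product of `W(x_σ)` over all
subsets `σ` of the index set. -/
noncomputable def faceted (W : Complexon) : Complexon where
  toFun m x := ∏ σ : Finset (Fin m), W.onFace x σ
  measurable_toFun m := by
    refine Measurable.subtype_mk (f := fun x => ((∏ σ : Finset (Fin m), W.onFace x σ :
      unitInterval) : ℝ)) (h := fun _ => Subtype.property _) ?_
    have h : ∀ (s : Finset (Finset (Fin m))),
        Measurable fun x : Fin m → unitInterval => ((∏ σ ∈ s, W.onFace x σ : unitInterval) : ℝ) := by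
      intro s
      induction s using Finset.cons_induction with
      | empty => simp
      | cons a s ha ih =>
        simp only [Finset.prod_cons, Set.Icc.coe_mul]
        exact (measurable_subtype_coe.comp (W.measurable_onFace a)).mul ih
    exact h _
  symmetric m π x := by
    simp only [W.onFace_comp_perm]
    exact Fintype.prod_equiv (Equiv.finsetCongr π) _ _ fun σ => rfl
  eq_one_of_le m x hm := by
    refine Finset.prod_eq_one fun σ _ => W.eq_one_of_le _ _ ?_
    exact (Finset.card_le_univ σ).trans (by simpa using hm)

/-- `W^φ(x_1, …, x_m) = W(φ(x_1), …, φ(x_m))` for a measurable map `φ : [0,1] → [0,1]`. -/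
def pullback (W : Complexon) (φ : unitInterval → unitInterval) (hφ : Measurable φ) :
    Complexon where
  toFun m x := W.toFun m (φ ∘ x)
  measurable_toFun m := (W.measurable_toFun m).comp
    (measurable_pi_lambda _ fun i => hφ.comp (measurable_pi_apply i))
  symmetric m π x := W.symmetric m π (φ ∘ x)
  eq_one_of_le m x hm := W.eq_one_of_le m _ hm

/-- The `d`-dimensional labeled cut distance: the supremum, over Borel sets
`S_1, …, S_{d+1} ⊆ [0,1]`, of `|∫_{S_1 × ⋯ × S_{d+1}} (U - W)|`. -/
noncomputable def cutDist (d : ℕ) (U W : Complexon) : ℝ :=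
  ⨆ S : {S : Fin (d + 1) → Set unitInterval // ∀ i, MeasurableSet (S i)},
    |∫ x in Set.univ.pi S.1, ((U.toFun (d + 1) x : ℝ) - (W.toFun (d + 1) x : ℝ))|

/-- The labeled cut distance for a finite sequence of weights: the weight `α j` (with `j : Fin d`,
so `j = 0, …, d - 1`) is the weight of dimension `j + 1`. -/
noncomputable def labeledCutDist {d : ℕ} (α : Fin d → ℝ) (U W : Complexon) : ℝ :=
  ∑ j : Fin d, α j * cutDist ((j : ℕ) + 1) U W

/-- The unlabeled cut distance: the infimum of the labeled cut distance of `U` and `W^φ` over all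
measure preserving transformations `φ` of `[0,1]`. -/
noncomputable def unlabeledCutDist {d : ℕ} (α : Fin d → ℝ) (U W : Complexon) : ℝ :=
  ⨅ φ : {φ : unitInterval → unitInterval // MeasurePreserving φ volume volume},
    labeledCutDist α U (W.pullback φ.1 φ.2.measurable)

/-- The interval `[j/n, (j+1)/n)`, for `j = 0, …, n - 1`. -/
def pixel (n : ℕ) (j : Fin n) : Set unitInterval :=
  {t | ((j : ℕ) : ℝ) / n ≤ (t : ℝ) ∧ (t : ℝ) < (((j : ℕ) : ℝ) + 1) / n}

theorem measurableSet_pixel (n : ℕ) (j : Fin n) : MeasurableSet (pixel n j) :=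
  (measurableSet_le measurable_const measurable_subtype_coe).inter
    (measurableSet_lt measurable_subtype_coe measurable_const)

/-- The set of those `(x_1, …, x_m)` whose entries lie in the pixels of the `m` distinct vertices
of an `(m-1)`-simplex of `K`. -/
def pixelSet {n : ℕ} (K : AbstractSimplicialComplex (Fin n)) (m : ℕ) :
    Set (Fin m → unitInterval) :=
  {x | ∃ j : Fin m → Fin n, Function.Injective j ∧ Finset.univ.image j ∈ K.faces ∧
    ∀ i, x i ∈ pixel n (j i)}

open Classical in
/-- The complexon `W_K` of a simplicial complex `K` on the vertex set `Fin n`: it is the indicator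
function of the union of the boxes given by the simplices of `K`, in each dimension `≥ 1`. -/
noncomputable def ofComplex {n : ℕ} (K : AbstractSimplicialComplex (Fin n)) : Complexon where
  toFun m x := if m ≤ 1 ∨ x ∈ pixelSet K m then 1 else 0
  measurable_toFun m := by
    refine Measurable.ite ?_ measurable_const measurable_const
    refine (MeasurableSet.const _).union ?_
    have : pixelSet K m = ⋃ j : Fin m → Fin n,
        {x | Function.Injective j ∧ Finset.univ.image j ∈ K.faces} ∩
          ⋂ i, (fun x : Fin m → unitInterval => x i) ⁻¹' pixel n (j i) := by
      ext x
      simp [pixelSet, and_assoc]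
    change MeasurableSet (pixelSet K m)
    rw [this]
    exact MeasurableSet.iUnion fun j => (MeasurableSet.const _).inter
      (MeasurableSet.iInter fun i => measurable_pi_apply i (measurableSet_pixel n (j i)))
  symmetric m π x := by
    have h : ∀ (ρ : Equiv.Perm (Fin m)) (y : Fin m → unitInterval),
        y ∈ pixelSet K m → y ∘ ρ ∈ pixelSet K m := by
      rintro ρ y ⟨j, hj, hK, hy⟩
      refine ⟨j ∘ ρ, hj.comp ρ.injective, ?_, fun i => hy (ρ i)⟩
      rwa [← Finset.image_image, Finset.image_univ_equiv]
    have h' : x ∘ π ∈ pixelSet K m ↔ x ∈ pixelSet K m := by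
      refine ⟨fun hx => ?_, h π x⟩
      have := h π.symm _ hx
      rwa [Function.comp_assoc, Equiv.self_comp_symm, Function.comp_id] at this
    simp only [h']
  eq_one_of_le m x hm := by simp [hm]

end Complexon

/-- The simplices produced by the inductive sampling procedure with weights `β` and coins `u`: all
vertices are present, and a set `σ` of at least two vertices is included exactly when all of its
nonempty strict subsets have been included and its coin satisfies `u σ ≤ β σ` (for a uniformly
distributed coin in `[0,1]`, an event of probability `β σ`). -/
inductive IsSampled {n : ℕ} (β u : Finset (Fin n) → unitInterval) : Finset (Fin n) → Prop
  | vertex (i : Fin n) : IsSampled β u {i}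
  | step (σ : Finset (Fin n)) (hσ : 2 ≤ σ.card)
      (hsub : ∀ τ : Finset (Fin n), τ.Nonempty → τ ⊂ σ → IsSampled β u τ)
      (hcoin : u σ ≤ β σ) : IsSampled β u σ

theorem IsSampled.nonempty {n : ℕ} {β u : Finset (Fin n) → unitInterval} {σ : Finset (Fin n)}
    (h : IsSampled β u σ) : σ.Nonempty := by
  cases h with
  | vertex i => exact Finset.singleton_nonempty i
  | step _ hσ _ _ => exact Finset.card_pos.mp (by omega)

theorem IsSampled.mono {n : ℕ} {β u : Finset (Fin n) → unitInterval} {σ τ : Finset (Fin n)}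
    (h : IsSampled β u σ) (hτ : τ ⊆ σ) (hne : τ.Nonempty) : IsSampled β u τ := by
  rcases eq_or_ne τ σ with rfl | hn
  · exact h
  · cases h with
    | vertex i =>
      exact absurd (hne.subset_singleton_iff.mp hτ) hn
    | step _ _ hsub _ => exact hsub τ hne (Finset.ssubset_iff_subset_ne.mpr ⟨hτ, hn⟩)

theorem isSampled_iff {n : ℕ} (β u : Finset (Fin n) → unitInterval) (σ : Finset (Fin n)) :
    IsSampled β u σ ↔ σ.Nonempty ∧ ∀ τ ⊆ σ, 2 ≤ τ.card → u τ ≤ β τ := by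
  constructor
  · intro h
    refine ⟨h.nonempty, fun τ hτ hc => ?_⟩
    have h' := h.mono hτ (Finset.card_pos.mp (by omega))
    cases h' with
    | vertex i => simp at hc
    | step _ _ _ hcoin => exact hcoin
  · induction σ using Finset.strongInduction with
    | H σ ih =>
      rintro ⟨hne, h⟩
      rcases Nat.lt_or_ge σ.card 2 with hc | hc
      · have h1 : σ.card = 1 := by have := hne.card_pos; omega
        obtain ⟨i, rfl⟩ := Finset.card_eq_one.mp h1
        exact IsSampled.vertex i
      · exact IsSampled.step σ hc
          (fun τ hτ hs => ih τ hs ⟨hτ, fun ρ hρ => h ρ (hρ.trans hs.subset)⟩)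
          (h σ subset_rfl hc)

/-- The simplicial complex on `n` vertices produced by the sampling procedure. -/
def sampledComplex {n : ℕ} (β u : Finset (Fin n) → unitInterval) :
    AbstractSimplicialComplex (Fin n) where
  faces := {σ | IsSampled β u σ}
  isRelLowerSet_faces := fun _ h => ⟨h.nonempty, fun _ hτ hne => IsSampled.mono h hτ hne⟩
  singleton_mem := fun i => IsSampled.vertex i

instance (n : ℕ) : MeasurableSpace (AbstractSimplicialComplex (Fin n)) := ⊤

/-- The random simplicial complex as a function of the points `x_1, …, x_n` and of the coins. -/
noncomputable def Complexon.sample (W : Complexon) (n : ℕ)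
    (p : (Fin n → unitInterval) × (Finset (Fin n) → unitInterval)) :
    AbstractSimplicialComplex (Fin n) :=
  sampledComplex (fun σ => W.onFace p.1 σ) p.2

theorem Complexon.measurable_sample (W : Complexon) (n : ℕ) : Measurable (W.sample n) := by
  have hinj : Function.Injective
      (fun K : AbstractSimplicialComplex (Fin n) => K.faces) := by
    intro K L h
    exact AbstractSimplicialComplex.ext h
  have : Finite (AbstractSimplicialComplex (Fin n)) := Finite.of_injective _ hinj
  have hface : ∀ σ : Finset (Fin n),
      MeasurableSet {p | σ ∈ (W.sample n p).faces} := by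
    intro σ
    have h : {p | σ ∈ (W.sample n p).faces} =
        {_p | σ.Nonempty} ∩ ⋂ τ : Finset (Fin n),
          ({_p | τ ⊆ σ ∧ 2 ≤ τ.card}ᶜ ∪ {p | p.2 τ ≤ W.onFace p.1 τ}) := by
      ext p
      simp only [Complexon.sample, sampledComplex, Set.mem_ofPred_eq, isSampled_iff,
        Set.mem_inter_iff, Set.mem_iInter, Set.mem_union, Set.mem_compl_iff]
      refine and_congr_right fun _ => forall_congr' fun τ => ?_
      tauto
    rw [h]
    refine (MeasurableSet.const _).inter (MeasurableSet.iInter fun τ =>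
      (MeasurableSet.const _).compl.union (measurableSet_le ?_ ?_))
    · exact (measurable_pi_apply τ).comp measurable_snd
    · exact (W.measurable_onFace τ).comp measurable_fst
  refine measurable_to_countable' fun F => ?_
  have h : W.sample n ⁻¹' {F} = ⋂ σ : Finset (Fin n),
      {p | σ ∈ (W.sample n p).faces ↔ σ ∈ F.faces} := by
    ext p
    simp only [Set.mem_preimage, Set.mem_singleton_iff, Set.mem_iInter, Set.mem_ofPred_eq]
    exact ⟨fun h σ => by rw [h], fun h => hinj (Set.ext h)⟩
  rw [h]
  refine MeasurableSet.iInter fun σ => ?_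
  by_cases hF : σ ∈ F.faces
  · simpa [hF] using hface σ
  · have h' : {p | σ ∈ (W.sample n p).faces ↔ σ ∈ F.faces} =
        {p | σ ∈ (W.sample n p).faces}ᶜ := by
      ext p
      simp [hF]
    rw [h']
    exact (hface σ).compl

/-- The distribution `𝕂(n, W)`: the points `x_1, …, x_n` and the coins are independent and
uniformly distributed on `[0,1]`. -/
noncomputable def Complexon.sampleLaw (W : Complexon) (n : ℕ) :
    Measure (AbstractSimplicialComplex (Fin n)) :=
  (volume : Measure ((Fin n → unitInterval) × (Finset (Fin n) → unitInterval))).map (W.sample n)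

instance (W : Complexon) (n : ℕ) : IsProbabilityMeasure (W.sampleLaw n) :=
  Measure.isProbabilityMeasure_map (W.measurable_sample n).aemeasurable

/-! Write `H` for the faceted complexon in dimension `m - 1`. Sorting the vertices by their sample
points makes the labels meaningful: the interval exchange of the permutation `Tuple.sort x` lets the
`k`-th pixel play the role of the vertex with the `k`-th smallest sample point. This one
measure-preserving map serves every dimension, so it suffices to bound each labeled cut distance
after it.

Let `idx` send `t` to the vertex of its pixel, put `k = idx ∘ y`, and approximate `H` in L¹ by a
continuous `g`. For almost every `y`, `H y` minus the pulled-back complexon is the sum of `H y - g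
y`, of `g y - g (x ∘ k)`, and of `g (x ∘ k)` minus the indicator that `k` spans a simplex. The first
term is small in L¹. The second is uniformly small, because order statistics are close to their
quantiles and `g` is uniformly continuous. In the third, non-injective tuples are a fraction O(1/n)
of all tuples. On injective ones, `g (x ∘ k) - H (x ∘ k)` is small on average by concentration of a
U-statistic, which leaves `H (x ∘ k)` minus the indicator.

Given `x`, that last difference has mean zero over the coins. Its integral over a product of Borel
sets is a multilinear form in weights from `[0,1]`, so it is largest at 0/1 weights, i.e. on one of
`2 ^ (n * m)` products of vertex sets. A coin affects only O(n^(m-2)) tuples, so the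
bounded-differences inequality gives a failure probability exp(-cn²) for each product, and the union
bound survives.

All failure probabilities are summable in `n`. The first Borel–Cantelli lemma uses only the
individual laws, which is why the joint distribution of the complexes is irrelevant. -/

/-! ### The bounded-differences inequality. -/

section McDiarmid

variable {Ω : Type*} [MeasurableSpace Ω]

/-- Induction by integrating out all coordinates but the first: given the first coordinate, the
induction hypothesis controls the fluctuation around the conditional mean `F`, and Hoeffding's lemma
controls `F` itself. The variance proxies add. -/
theorem hasSubgaussianMGF_of_bounded_differences_fin (μ : Measure Ω) [IsProbabilityMeasure μ]
    (n : ℕ) (f : (Fin n → Ω) → ℝ) (hf : Measurable f) (M : ℝ) (hM : ∀ x, |f x| ≤ M)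
    (c : Fin n → NNReal)
    (hc : ∀ (i : Fin n) (x : Fin n → Ω) (a : Ω), |f (Function.update x i a) - f x| ≤ c i) :
    HasSubgaussianMGF (fun x => f x - ∫ y, f y ∂(Measure.pi fun _ => μ)) (∑ i, (c i / 2) ^ 2)
      (Measure.pi fun _ => μ) := by
  induction n with
  | zero =>
    have h : (fun x => f x - ∫ y, f y ∂(Measure.pi fun _ => μ)) = fun _ => 0 := by
      funext x
      have : f = fun _ => f x := by
        funext y
        rw [Subsingleton.elim y x]
      rw [this]
      simp
    rw [h]
    simp
  | succ n ih =>
    set ν : Measure (Fin n → Ω) := Measure.pi fun _ => μ with hν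
    set g : Ω × (Fin n → Ω) → ℝ := fun p => f (Fin.cons p.1 p.2) with hg
    have hcons : Measurable fun p : Ω × (Fin n → Ω) => (Fin.cons p.1 p.2 : Fin (n + 1) → Ω) := by
      refine measurable_pi_lambda _ fun i => ?_
      refine Fin.cases ?_ (fun j => ?_) i
      · simp [measurable_fst]
      · exact (measurable_pi_apply j).comp measurable_snd
    have hgm : Measurable g := hf.comp hcons
    have hmp : MeasurePreserving (fun p : Ω × (Fin n → Ω) => (Fin.cons p.1 p.2 : Fin (n + 1) → Ω))
        (μ.prod ν) (Measure.pi fun _ => μ) := by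
      have := (measurePreserving_piFinSuccAbove (fun _ : Fin (n + 1) => μ) 0).symm
      convert this using 1
      funext p
      simp [MeasurableEquiv.piFinSuccAbove, Fin.insertNthEquiv]
    set F : Ω → ℝ := fun a => ∫ y, g (a, y) ∂ν with hF
    have hgi : ∀ a, Integrable (fun y => g (a, y)) ν := fun a =>
      Integrable.of_bound (hgm.comp measurable_prodMk_left).aestronglyMeasurable M
        (ae_of_all _ fun y => by simpa using hM _)
    have hgI : Integrable g (μ.prod ν) :=
      Integrable.of_bound hgm.aestronglyMeasurable M (ae_of_all _ fun y => by simpa using hM _)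
    have hFm : Measurable F :=
      (StronglyMeasurable.integral_prod_right (ν := ν) (f := fun a y => g (a, y))
        hgm.stronglyMeasurable).measurable
    have hEf : ∫ y, f y ∂(Measure.pi fun _ : Fin (n + 1) => μ) = ∫ a, F a ∂μ := by
      rw [← hmp.map_eq, integral_map hcons.aemeasurable hf.aestronglyMeasurable]
      exact integral_prod g hgI
    have hFc : ∀ a b, F a ≤ F b + c 0 := by
      intro a b
      have h1 : ∀ y, g (a, y) ≤ g (b, y) + c 0 := by
        intro y
        have := (abs_le.mp (hc 0 (Fin.cons b y) a)).2
        simp only [Fin.update_cons_zero] at this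
        simp only [hg]
        linarith
      calc F a ≤ ∫ y, (g (b, y) + c 0) ∂ν :=
            integral_mono (hgi a) ((hgi b).add (integrable_const _)) h1
        _ = F b + c 0 := by
            rw [integral_add (hgi b) (integrable_const _)]
            simp [hF]
    have hFM : ∀ a, |F a| ≤ M := by
      intro a
      have := norm_integral_le_of_norm_le_const (μ := ν) (f := fun y => g (a, y)) (C := M)
        (ae_of_all _ fun y => by simpa using hM _)
      simpa using this
    have : Nonempty Ω := by
      by_contra h
      rw [not_nonempty_iff] at h
      have h1 := measure_univ (μ := μ)
      rw [Set.univ_eq_empty_iff.mpr h] at h1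
      simp at h1
    have hbdd : BddBelow (Set.range F) :=
      ⟨-M, by rintro _ ⟨a, rfl⟩; exact (abs_le.mp (hFM a)).1⟩
    -- By `hFc` the oscillation of `F` is at most `c 0`, so its values lie in an interval of that
    -- length starting at the infimum.
    have hoeff := hasSubgaussianMGF_of_mem_Icc (μ := μ) (X := F) (a := ⨅ a, F a)
      (b := (⨅ a, F a) + c 0) hFm.aemeasurable (ae_of_all _ fun a => ⟨ciInf_le hbdd a, by
        have : F a - c 0 ≤ ⨅ b, F b := le_ciInf fun b => by linarith [hFc a b]
        linarith⟩)
    have hc0 : (‖(⨅ a, F a) + (c 0 : ℝ) - ⨅ a, F a‖₊ / 2) ^ 2 = (c 0 / 2) ^ 2 := by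
      simp
    rw [hc0] at hoeff
    have hin : ∀ a, HasSubgaussianMGF (fun y => g (a, y) - F a) (∑ i : Fin n, (c i.succ / 2) ^ 2) ν :=
      fun a => ih (fun y => g (a, y)) (hgm.comp measurable_prodMk_left) (fun y => hM _)
        (fun i => c i.succ) (fun i y b => by
          have := hc i.succ (Fin.cons a y) b
          rwa [← Fin.cons_update] at this)
    have hexp : ∀ t, Measurable fun x => Real.exp (t * (f x - ∫ a, F a ∂μ)) := fun t =>
      Real.measurable_exp.comp ((hf.sub_const _).const_mul t)
    have hbound : ∀ t x, ‖Real.exp (t * (f x - ∫ a, F a ∂μ))‖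
        ≤ Real.exp (|t| * (M + |∫ a, F a ∂μ|)) := by
      intro t x
      rw [Real.norm_eq_abs, Real.abs_exp]
      refine Real.exp_le_exp.mpr ((le_abs_self _).trans ?_)
      rw [abs_mul]
      gcongr
      exact (abs_sub _ _).trans (by gcongr; exact hM x)
    rw [hEf]
    refine ⟨fun t => Integrable.of_bound (hexp t).aestronglyMeasurable _
      (ae_of_all _ (hbound t)), fun t => ?_⟩
    have hI : Integrable (fun p => Real.exp (t * (g p - ∫ a, F a ∂μ))) (μ.prod ν) :=
      Integrable.of_bound ((hexp t).comp hcons).aestronglyMeasurable _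
        (ae_of_all _ fun p => hbound t _)
    rw [mgf, ← hmp.map_eq, integral_map hcons.aemeasurable (hexp t).aestronglyMeasurable]
    change ∫ p, Real.exp (t * (g p - ∫ a, F a ∂μ)) ∂(μ.prod ν) ≤ _
    rw [integral_prod _ hI]
    set V : NNReal := ∑ i : Fin n, (c i.succ / 2) ^ 2 with hV
    -- Split the exponent as `(g (a, y) - F a) + (F a - ∫ F)`; the second summand does not depend on
    -- `y`.
    have hstep : ∀ a, ∫ y, Real.exp (t * (g (a, y) - ∫ a, F a ∂μ)) ∂ν
        ≤ Real.exp (V * t ^ 2 / 2) * Real.exp (t * (F a - ∫ a, F a ∂μ)) := by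
      intro a
      have h1 : ∀ y, Real.exp (t * (g (a, y) - ∫ a, F a ∂μ))
          = Real.exp (t * (g (a, y) - F a)) * Real.exp (t * (F a - ∫ a, F a ∂μ)) := by
        intro y
        rw [← Real.exp_add]
        ring_nf
      simp_rw [h1]
      rw [integral_mul_const]
      gcongr
      exact (hin a).mgf_le t
    calc ∫ a, ∫ y, Real.exp (t * (g (a, y) - ∫ a, F a ∂μ)) ∂ν ∂μ
        ≤ ∫ a, Real.exp (V * t ^ 2 / 2) * Real.exp (t * (F a - ∫ a, F a ∂μ)) ∂μ :=
          integral_mono hI.integral_prod_left ((hoeff.integrable_exp_mul t).const_mul _) hstep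
      _ = Real.exp (V * t ^ 2 / 2) * mgf (fun a => F a - ∫ a, F a ∂μ) μ t := by
          rw [integral_const_mul]; rfl
      _ ≤ Real.exp (V * t ^ 2 / 2) * Real.exp (((c 0 / 2) ^ 2 : NNReal) * t ^ 2 / 2) := by
          gcongr
          exact hoeff.mgf_le t
      _ = _ := by
          rw [← Real.exp_add, Fin.sum_univ_succ, ← hV]
          congr 1
          push_cast
          ring

theorem hasSubgaussianMGF_of_bounded_differences {ι : Type*} [Fintype ι] [DecidableEq ι]
    (μ : Measure Ω) [IsProbabilityMeasure μ] (f : (ι → Ω) → ℝ) (hf : Measurable f) (M : ℝ)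
    (hM : ∀ x, |f x| ≤ M) (c : ι → NNReal)
    (hc : ∀ (i : ι) (x : ι → Ω) (a : Ω), |f (Function.update x i a) - f x| ≤ c i) :
    HasSubgaussianMGF (fun x => f x - ∫ y, f y ∂(Measure.pi fun _ => μ)) (∑ i, (c i / 2) ^ 2)
      (Measure.pi fun _ => μ) := by
  classical
  let e := (Fintype.equivFin ι).symm
  have hmp : MeasurePreserving (MeasurableEquiv.piCongrLeft (fun _ : ι => Ω) e)
      (Measure.pi fun _ => μ) (Measure.pi fun _ => μ) :=
    measurePreserving_piCongrLeft (fun _ : ι => μ) e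
  have he : ∀ x : Fin (Fintype.card ι) → Ω,
      MeasurableEquiv.piCongrLeft (fun _ : ι => Ω) e x = x ∘ e.symm := by
    intro x
    funext i
    obtain ⟨j, rfl⟩ := e.surjective i
    rw [MeasurableEquiv.coe_piCongrLeft, Equiv.piCongrLeft_apply_apply]
    simp
  have key := hasSubgaussianMGF_of_bounded_differences_fin μ (Fintype.card ι)
    (fun x => f (MeasurableEquiv.piCongrLeft (fun _ : ι => Ω) e x))
    (hf.comp (MeasurableEquiv.measurable _)) M (fun x => hM _) (fun i => c (e i))
    (fun i x a => by
      have := hc (e i) (x ∘ e.symm) a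
      rw [he, he]
      convert this using 3
      rw [Function.update_comp_equiv]
      simp)
  have hint : ∫ y, f (MeasurableEquiv.piCongrLeft (fun _ : ι => Ω) e y)
      ∂(Measure.pi fun _ => μ) = ∫ y, f y ∂(Measure.pi fun _ => μ) :=
    hmp.integral_comp (MeasurableEquiv.measurableEmbedding _) f
  rw [hint, Equiv.sum_comp e (fun i => (c i / 2) ^ 2)] at key
  rw [← (hmp.symm _).map_eq] at key
  have h := HasSubgaussianMGF.of_map (MeasurableEquiv.measurable _).aemeasurable key
  convert! h using 1
  funext x
  simp

/-- McDiarmid's inequality, upper tail. -/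
theorem measure_ge_le_of_bounded_differences {ι : Type*} [Fintype ι] [DecidableEq ι]
    (μ : Measure Ω) [IsProbabilityMeasure μ] (f : (ι → Ω) → ℝ) (hf : Measurable f) (M : ℝ)
    (hM : ∀ x, |f x| ≤ M) (c : ι → NNReal)
    (hc : ∀ (i : ι) (x : ι → Ω) (a : Ω), |f (Function.update x i a) - f x| ≤ c i)
    {V : ℝ} (hVpos : 0 < V) (hV : ∑ i, (c i : ℝ) ^ 2 ≤ V) {ε : ℝ} (hε : 0 ≤ ε) :
    (Measure.pi fun _ => μ) {x | ε ≤ f x - ∫ y, f y ∂(Measure.pi fun _ => μ)}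
      ≤ ENNReal.ofReal (Real.exp (-2 * ε ^ 2 / V)) := by
  have h := hasSubgaussianMGF_of_bounded_differences μ f hf M hM c hc
  have hle : ((∑ i, (c i / 2) ^ 2 : NNReal) : ℝ) ≤ V / 4 := by
    push_cast
    calc ∑ i, ((c i : ℝ) / 2) ^ 2 = (∑ i, (c i : ℝ) ^ 2) / 4 := by
          rw [Finset.sum_div]
          exact Finset.sum_congr rfl fun i _ => by ring
      _ ≤ V / 4 := by gcongr
  -- Enlarging the variance proxy to `V / 4` keeps the mgf bound, and it is this quarter that
  -- produces the factor 2 in the exponent.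
  have h' : HasSubgaussianMGF (fun x => f x - ∫ y, f y ∂(Measure.pi fun _ => μ))
      ⟨V / 4, by positivity⟩ (Measure.pi fun _ => μ) :=
    ⟨h.integrable_exp_mul, fun t => (h.mgf_le t).trans (by
      refine Real.exp_le_exp.mpr ?_
      have : (0 : ℝ) ≤ t ^ 2 := sq_nonneg t
      change _ ≤ (V / 4) * t ^ 2 / 2
      gcongr)⟩
  have h2 := h'.measure_ge_le hε
  rw [← ofReal_measureReal]
  refine ENNReal.ofReal_le_ofReal (h2.trans (Real.exp_le_exp.mpr (le_of_eq ?_)))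
  change -ε ^ 2 / (2 * (V / 4)) = _
  field_simp
  norm_num

/-- McDiarmid's inequality, both tails. -/
theorem measure_abs_ge_le_of_bounded_differences {ι : Type*} [Fintype ι] [DecidableEq ι]
    (μ : Measure Ω) [IsProbabilityMeasure μ] (f : (ι → Ω) → ℝ) (hf : Measurable f) (M : ℝ)
    (hM : ∀ x, |f x| ≤ M) (c : ι → NNReal)
    (hc : ∀ (i : ι) (x : ι → Ω) (a : Ω), |f (Function.update x i a) - f x| ≤ c i)
    {V : ℝ} (hVpos : 0 < V) (hV : ∑ i, (c i : ℝ) ^ 2 ≤ V) {ε : ℝ} (hε : 0 ≤ ε) :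
    (Measure.pi fun _ => μ) {x | ε ≤ |f x - ∫ y, f y ∂(Measure.pi fun _ => μ)|}
      ≤ ENNReal.ofReal (2 * Real.exp (-2 * ε ^ 2 / V)) := by
  have h1 := measure_ge_le_of_bounded_differences μ f hf M hM c hc hVpos hV hε
  have h2 := measure_ge_le_of_bounded_differences μ (fun x => -f x) hf.neg M
    (fun x => by simpa using hM x) c
    (fun i x a => by
      have := hc i x a
      rwa [← abs_neg, show -(-f (Function.update x i a) - -f x) = f (Function.update x i a) - f x
        by ring]) hVpos hV hε
  rw [two_mul, ENNReal.ofReal_add (by positivity) (by positivity)]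
  refine (measure_mono ?_).trans ((measure_union_le _ _).trans (add_le_add h1 h2))
  intro x hx
  rcases le_abs.mp (Set.mem_ofPred_eq.mp hx) with h | h
  · exact Or.inl h
  · refine Or.inr ?_
    simp only [Set.mem_ofPred_eq, integral_neg]
    linarith

end McDiarmid

/-! ### Counting tuples of vertices. -/

section Counting

/-- A tuple of `A` is determined by its entries off `T`, so `A` embeds into the functions on the
complement. Stated as a product to avoid the subtraction `m - T.card`. -/
theorem card_mul_pow_le_of_forall_eq {m n : ℕ} (T : Finset (Fin m)) (A : Finset (Fin m → Fin n))
    (hA : ∀ k ∈ A, ∀ k' ∈ A, (∀ i ∉ T, k i = k' i) → k = k') : A.card * n ^ T.card ≤ n ^ m := by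
  classical
  have h1 : A.card ≤ Fintype.card ({i // i ∉ T} → Fin n) := by
    rw [← Finset.card_univ]
    refine Finset.card_le_card_of_injOn (fun k i => k i.1) (fun _ _ => Finset.mem_coe.mpr (Finset.mem_univ _)) ?_
    intro k hk k' hk' h
    exact hA k hk k' hk' fun i hi => congrFun h ⟨i, hi⟩
  have h2 : Fintype.card {i // i ∉ T} + T.card = m := by
    rw [Fintype.card_subtype_compl]
    have := T.card_le_univ
    simp at this ⊢
    omega
  calc A.card * n ^ T.card ≤ n ^ Fintype.card {i // i ∉ T} * n ^ T.card := by
        gcongr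
        simpa using h1
    _ = n ^ m := by rw [← pow_add, h2]

theorem card_filter_not_injective_mul_le (m n : ℕ) [DecidablePred fun k : Fin m → Fin n => ¬ Function.Injective k] :
    (Finset.univ.filter fun k : Fin m → Fin n => ¬ Function.Injective k).card * n
      ≤ m ^ 2 * n ^ m := by
  classical
  have hsub : (Finset.univ.filter fun k : Fin m → Fin n => ¬ Function.Injective k) ⊆
      ((Finset.univ : Finset (Fin m × Fin m)).filter fun p => p.1 ≠ p.2).biUnion fun p =>
        Finset.univ.filter fun k : Fin m → Fin n => k p.1 = k p.2 := by
    intro k hk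
    simp only [Finset.mem_filter, Finset.mem_univ, true_and, Function.Injective, not_forall] at hk
    obtain ⟨a, b, h, hab⟩ := hk
    exact Finset.mem_biUnion.mpr ⟨(a, b), by simpa using hab, by simpa using h⟩
  calc _ ≤ (∑ p ∈ ((Finset.univ : Finset (Fin m × Fin m)).filter fun p => p.1 ≠ p.2),
        (Finset.univ.filter fun k : Fin m → Fin n => k p.1 = k p.2).card) * n := by
        gcongr
        exact (Finset.card_le_card hsub).trans Finset.card_biUnion_le
    _ ≤ ∑ p ∈ ((Finset.univ : Finset (Fin m × Fin m)).filter fun p => p.1 ≠ p.2), n ^ m := by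
        rw [Finset.sum_mul]
        refine Finset.sum_le_sum fun p hp => ?_
        have := card_mul_pow_le_of_forall_eq {p.1}
          (Finset.univ.filter fun k : Fin m → Fin n => k p.1 = k p.2) (by
            intro k hk k' hk' h
            simp only [Finset.mem_filter, Finset.mem_univ, true_and] at hk hk' hp
            funext i
            by_cases hi : i = p.1
            · rw [hi, hk, hk']
              exact h _ (by simpa using hp.symm)
            · exact h i (by simpa using hi))
        simpa using this
    _ ≤ m ^ 2 * n ^ m := by
        rw [Finset.sum_const, smul_eq_mul]
        gcongr
        refine (Finset.card_le_univ _).trans ?_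
        simp [sq]

theorem card_filter_exists_eq_mul_le (m : ℕ) {n : ℕ} (a : Fin n) :
    (Finset.univ.filter fun k : Fin m → Fin n => ∃ s, k s = a).card * n ≤ m * n ^ m := by
  classical
  have hsub : (Finset.univ.filter fun k : Fin m → Fin n => ∃ s, k s = a) ⊆
      (Finset.univ : Finset (Fin m)).biUnion fun s =>
        Finset.univ.filter fun k : Fin m → Fin n => k s = a := by
    intro k hk
    simpa using hk
  calc _ ≤ (∑ s : Fin m, (Finset.univ.filter fun k : Fin m → Fin n => k s = a).card) * n := by
        gcongr
        exact (Finset.card_le_card hsub).trans Finset.card_biUnion_le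
    _ ≤ ∑ _s : Fin m, n ^ m := by
        rw [Finset.sum_mul]
        refine Finset.sum_le_sum fun s _ => ?_
        have := card_mul_pow_le_of_forall_eq {s}
          (Finset.univ.filter fun k : Fin m → Fin n => k s = a) (by
            intro k hk k' hk' h
            simp only [Finset.mem_filter, Finset.mem_univ, true_and] at hk hk'
            funext i
            by_cases hi : i = s
            · rw [hi, hk, hk']
            · exact h i (by simpa using hi))
        simpa using this
    _ = m * n ^ m := by simp

theorem card_filter_exists_eq_and_mul_le (m : ℕ) {n : ℕ} {a b : Fin n} (hab : a ≠ b) :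
    (Finset.univ.filter fun k : Fin m → Fin n => (∃ s, k s = a) ∧ ∃ t, k t = b).card * n ^ 2
      ≤ m ^ 2 * n ^ m := by
  classical
  have hsub : (Finset.univ.filter fun k : Fin m → Fin n => (∃ s, k s = a) ∧ ∃ t, k t = b) ⊆
      (Finset.univ : Finset (Fin m × Fin m)).biUnion fun p =>
        Finset.univ.filter fun k : Fin m → Fin n => k p.1 = a ∧ k p.2 = b := by
    intro k hk
    simp only [Finset.mem_filter, Finset.mem_univ, true_and] at hk
    obtain ⟨⟨s, hs⟩, t, ht⟩ := hk
    exact Finset.mem_biUnion.mpr ⟨(s, t), Finset.mem_univ _, by simp [hs, ht]⟩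
  calc _ ≤ (∑ p : Fin m × Fin m,
        (Finset.univ.filter fun k : Fin m → Fin n => k p.1 = a ∧ k p.2 = b).card) * n ^ 2 := by
        gcongr
        exact (Finset.card_le_card hsub).trans Finset.card_biUnion_le
    _ ≤ ∑ _p : Fin m × Fin m, n ^ m := by
        rw [Finset.sum_mul]
        refine Finset.sum_le_sum fun p _ => ?_
        rcases eq_or_ne p.1 p.2 with hp | hp
        · have : (Finset.univ.filter fun k : Fin m → Fin n => k p.1 = a ∧ k p.2 = b) = ∅ := by
            refine Finset.filter_eq_empty_iff.mpr fun k _ h => hab ?_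
            rw [← h.1, ← h.2, hp]
          simp [this]
        · have := card_mul_pow_le_of_forall_eq {p.1, p.2}
            (Finset.univ.filter fun k : Fin m → Fin n => k p.1 = a ∧ k p.2 = b) (by
              intro k hk k' hk' h
              simp only [Finset.mem_filter, Finset.mem_univ, true_and] at hk hk'
              funext i
              by_cases hi : i = p.1
              · rw [hi, hk.1, hk'.1]
              by_cases hi2 : i = p.2
              · rw [hi2, hk.2, hk'.2]
              · exact h i (by simp [hi, hi2]))
          rwa [Finset.card_pair hp] at this
    _ = m ^ 2 * n ^ m := by simp [sq]

end Counting

/-! ### From fractional weights to vertex sets. -/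

section Multilinear

/-- `hΦ` says that `Φ` is affine in each variable, so moving one variable at a time to an endpoint
shows that `|Φ|` on the cube is bounded by its values at the vertices. In `key`, `T` is the set of
variables still allowed inside the interval. -/
theorem abs_le_of_forall_update {J : Type*} [Fintype J] [DecidableEq J] (Φ : (J → ℝ) → ℝ)
    (hΦ : ∀ w j, Φ w = w j * Φ (Function.update w j 1) + (1 - w j) * Φ (Function.update w j 0))
    {C : ℝ} (hC : ∀ w, (∀ j, w j = 0 ∨ w j = 1) → |Φ w| ≤ C) (w : J → ℝ)
    (hw : ∀ j, 0 ≤ w j ∧ w j ≤ 1) : |Φ w| ≤ C := by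
  have key : ∀ T : Finset J, ∀ w : J → ℝ, (∀ j, 0 ≤ w j ∧ w j ≤ 1) →
      (∀ j ∉ T, w j = 0 ∨ w j = 1) → |Φ w| ≤ C := by
    intro T
    induction T using Finset.induction_on with
    | empty => exact fun w _ h => hC w fun j => h j (Finset.notMem_empty j)
    | insert a T _ ih =>
      intro w hw h
      have hup : ∀ t : ℝ, (t = 0 ∨ t = 1) → |Φ (Function.update w a t)| ≤ C := by
        intro t ht
        refine ih _ (fun j => ?_) fun j hj => ?_
        · rcases eq_or_ne j a with rfl | hja
          · rcases ht with rfl | rfl <;> simp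
          · simpa [hja] using hw j
        · rcases eq_or_ne j a with rfl | hja
          · simpa using ht
          · simpa [hja] using h j (by simp [hja, hj])
      have h0 := abs_le.mp (hup 0 (Or.inl rfl))
      have h1 := abs_le.mp (hup 1 (Or.inr rfl))
      obtain ⟨ha0, ha1⟩ := hw a
      rw [hΦ w a, abs_le]
      constructor <;> nlinarith
  exact key Finset.univ w hw fun j hj => absurd (Finset.mem_univ j) hj

/-- The sum is affine in each single weight `w l i`, since a product over `l` contains that weight
at most once. At 0/1 weights it is the sum over a product of finsets. -/
theorem abs_sum_prod_mul_le_of_forall_finset {m n : ℕ} (G : (Fin m → Fin n) → ℝ) {C : ℝ}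
    (hC : ∀ S : Fin m → Finset (Fin n),
      |∑ k ∈ Finset.univ.filter (fun k : Fin m → Fin n => ∀ l, k l ∈ S l), G k| ≤ C)
    (w : Fin m → Fin n → ℝ) (hw : ∀ l i, 0 ≤ w l i ∧ w l i ≤ 1) :
    |∑ k, (∏ l, w l (k l)) * G k| ≤ C := by
  classical
  let Φ : (Fin m × Fin n → ℝ) → ℝ := fun v => ∑ k : Fin m → Fin n, (∏ l, v (l, k l)) * G k
  refine abs_le_of_forall_update Φ ?_ ?_ (fun p => w p.1 p.2) fun p => hw p.1 p.2
  · rintro v ⟨l, i⟩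
    simp only [Φ, Finset.mul_sum]
    rw [← Finset.sum_add_distrib]
    refine Finset.sum_congr rfl fun k _ => ?_
    have hsplit : ∀ t : ℝ, ∏ l', Function.update v (l, i) t (l', k l')
        = Function.update v (l, i) t (l, k l) * ∏ l' ∈ Finset.univ.erase l, v (l', k l') := by
      intro t
      rw [← Finset.mul_prod_erase _ _ (Finset.mem_univ l)]
      congr 1
      refine Finset.prod_congr rfl fun l' hl' => ?_
      have : (l', k l') ≠ (l, i) := fun h => (Finset.ne_of_mem_erase hl') (congrArg Prod.fst h)
      simp [this]
    rw [hsplit, hsplit, ← Finset.mul_prod_erase _ _ (Finset.mem_univ l)]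
    by_cases hk : k l = i
    · simp [hk]
      ring
    · have : (l, k l) ≠ (l, i) := fun h => hk (congrArg Prod.snd h)
      simp only [Function.update_of_ne this]
      ring
  · intro v hv
    convert hC fun l => Finset.univ.filter fun i => v (l, i) = 1 using 2
    simp only [Φ, Finset.sum_filter]
    refine Finset.sum_congr rfl fun k _ => ?_
    split_ifs with h
    · simp only [Finset.mem_filter, Finset.mem_univ, true_and] at h
      simp [h]
    · simp only [Finset.mem_filter, Finset.mem_univ, true_and, not_forall] at h
      obtain ⟨l, hl⟩ := h
      rw [Finset.prod_eq_zero (Finset.mem_univ l) ((hv _).resolve_right hl), zero_mul]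

end Multilinear

/-! ### Injective tuples and concentration in the sample points. -/

section Tuples

open Classical in
/-- The injective `m`-tuples of elements of `Fin n`. -/
noncomputable def injTuples (m n : ℕ) : Finset (Fin m → Fin n) :=
  Finset.univ.filter Function.Injective

theorem mem_injTuples {m n : ℕ} {k : Fin m → Fin n} : k ∈ injTuples m n ↔ Function.Injective k := by
  simp [injTuples]

theorem card_injTuples_le (m n : ℕ) : ((injTuples m n).card : ℝ) ≤ (n : ℝ) ^ m := by
  have := Finset.card_le_univ (injTuples m n)
  simp only [Fintype.card_pi, Finset.prod_const, Finset.card_univ, Fintype.card_fin] at this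
  exact_mod_cast this

theorem card_compl_injTuples_le (m : ℕ) {n : ℕ} (hn : 1 ≤ n) :
    (((injTuples m n)ᶜ.card : ℕ) : ℝ) ≤ m ^ 2 * (n : ℝ) ^ m / n := by
  classical
  have h := card_filter_not_injective_mul_le m n
  have hc : (injTuples m n)ᶜ = Finset.univ.filter fun k : Fin m → Fin n => ¬ Function.Injective k := by
    ext k
    simp [mem_injTuples]
  rw [hc, le_div_iff₀ (by exact_mod_cast hn)]
  exact_mod_cast h

/-- Distinct coordinates of a uniform point are independent and uniform. -/
theorem measurePreserving_comp_of_injective {m n : ℕ} {k : Fin m → Fin n}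
    (hk : Function.Injective k) :
    MeasurePreserving (fun x : Fin n → unitInterval => x ∘ k) volume volume := by
  have hm : Measurable fun x : Fin n → unitInterval => x ∘ k :=
    measurable_pi_lambda _ fun i => measurable_pi_apply _
  refine ⟨hm, ?_⟩
  have h1 : iIndepFun (fun (i : Fin n) (x : Fin n → unitInterval) => x i)
      (volume : Measure (Fin n → unitInterval)) :=
    iIndepFun_pi (X := fun _ => id) fun _ => aemeasurable_id
  have h2 := h1.precomp hk
  rw [iIndepFun_iff_map_fun_eq_pi_map fun i => (measurable_pi_apply _).aemeasurable] at h2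
  refine h2.trans ?_
  rw [volume_pi]
  congr 1
  funext i
  exact (measurePreserving_eval (fun _ : Fin n => (volume : Measure unitInterval)) (k i)).map_eq

/-- Concentration of `U`-statistics. -/
theorem measure_abs_sum_injTuples_sub_le {m n : ℕ} (hm : 1 ≤ m) (hn : 1 ≤ n)
    (h : (Fin m → unitInterval) → ℝ) (hh : Measurable h) (h0 : ∀ y, 0 ≤ h y) (h1 : ∀ y, h y ≤ 1)
    {ε : ℝ} (hε : 0 ≤ ε) :
    volume {x : Fin n → unitInterval | ε * (n : ℝ) ^ m ≤
        |∑ k ∈ injTuples m n, h (x ∘ k) - (injTuples m n).card * ∫ y, h y|}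
      ≤ ENNReal.ofReal (2 * Real.exp (-(2 * ε ^ 2 / m ^ 2) * n)) := by
  classical
  have hn' : (0 : ℝ) < n := by exact_mod_cast hn
  have hm' : (0 : ℝ) < m := by exact_mod_cast hm
  set f : (Fin n → unitInterval) → ℝ := fun x => ∑ k ∈ injTuples m n, h (x ∘ k) with hf
  have hcomp : ∀ k : Fin m → Fin n, Measurable fun x : Fin n → unitInterval => x ∘ k :=
    fun k => measurable_pi_lambda _ fun i => measurable_pi_apply _
  have hfm : Measurable f := Finset.measurable_sum _ fun k _ => hh.comp (hcomp k)
  have hint : ∫ x, f x = (injTuples m n).card * ∫ y, h y := by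
    have hi : ∀ k ∈ injTuples m n, Integrable fun x : Fin n → unitInterval => h (x ∘ k) :=
      fun k _ => Integrable.of_bound (hh.comp (hcomp k)).aestronglyMeasurable 1
        (ae_of_all _ fun x => by
          rw [Real.norm_eq_abs]
          exact (abs_of_nonneg (h0 (x ∘ k))).trans_le (h1 (x ∘ k)))
    rw [show (∫ x, f x) = ∫ x, ∑ k ∈ injTuples m n, h (x ∘ k) from rfl, integral_finsetSum _ hi]
    rw [Finset.sum_congr rfl (g := fun _ => ∫ y, h y), Finset.sum_const, nsmul_eq_mul]
    intro k hk
    have hmp := measurePreserving_comp_of_injective (mem_injTuples.mp hk)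
    rw [← hmp.map_eq, integral_map hmp.measurable.aemeasurable hh.aestronglyMeasurable]
  have hfM : ∀ x, |f x| ≤ (injTuples m n).card := by
    intro x
    rw [abs_of_nonneg (Finset.sum_nonneg fun k _ => h0 _)]
    calc f x ≤ ∑ k ∈ injTuples m n, (1 : ℝ) := Finset.sum_le_sum fun k _ => h1 _
      _ = _ := by simp
  -- Moving one sample point affects only the tuples through that vertex, at most `m * n ^ (m - 1)`
  -- of them, each by at most 1.
  have hdiff : ∀ (i : Fin n) (x : Fin n → unitInterval) (a : unitInterval),
      |f (Function.update x i a) - f x| ≤ ((⟨m * (n : ℝ) ^ m / n, by positivity⟩ : NNReal) : ℝ) := by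
    intro i x a
    change _ ≤ m * (n : ℝ) ^ m / n
    simp only [hf]
    rw [← Finset.sum_sub_distrib]
    have hk : ∀ k ∈ injTuples m n, |h (Function.update x i a ∘ k) - h (x ∘ k)|
        ≤ if ∃ s, k s = i then (1 : ℝ) else 0 := by
      intro k _
      split_ifs with hs
      · rw [abs_le]
        constructor <;> linarith [h0 (Function.update x i a ∘ k), h1 (Function.update x i a ∘ k),
          h0 (x ∘ k), h1 (x ∘ k)]
      · have : Function.update x i a ∘ k = x ∘ k := by
          funext s
          exact Function.update_of_ne (fun he => hs ⟨s, he⟩) _ _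
        rw [this]
        simp
    refine (Finset.abs_sum_le_sum_abs _ _).trans ((Finset.sum_le_sum hk).trans ?_)
    rw [← Finset.sum_filter, Finset.sum_const, nsmul_eq_mul, mul_one, le_div_iff₀ hn']
    have h3 := card_filter_exists_eq_mul_le m i
    have h4 : ((injTuples m n).filter fun k => ∃ s, k s = i).card * n ≤ m * n ^ m := by
      refine le_trans ?_ h3
      gcongr
      exact Finset.subset_univ _
    exact_mod_cast h4
  have key := measure_abs_ge_le_of_bounded_differences (volume : Measure unitInterval) f hfm _ hfM _
    hdiff (V := m ^ 2 * (n : ℝ) ^ (2 * m) / n) (by positivity) (by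
      simp only [Finset.sum_const, Finset.card_univ, Fintype.card_fin, nsmul_eq_mul]
      refine le_of_eq ?_
      change (n : ℝ) * (m * (n : ℝ) ^ m / n) ^ 2 = _
      field_simp
      ring) (ε := ε * (n : ℝ) ^ m) (by positivity)
  rw [← volume_pi, hint] at key
  refine key.trans (le_of_eq ?_)
  congr 3
  field_simp
  ring

/-- Concentration of the empirical distribution function. -/
theorem measure_abs_card_le_sub_le {n : ℕ} (hn : 1 ≤ n) (t : unitInterval) {ε : ℝ} (hε : 0 ≤ ε) :
    volume {x : Fin n → unitInterval | ε * n ≤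
        |((Finset.univ.filter fun i => x i ≤ t).card : ℝ) - n * t|}
      ≤ ENNReal.ofReal (2 * Real.exp (-(2 * ε ^ 2) * n)) := by
  classical
  -- The counting function is the U-statistic of order 1 with kernel the indicator of `Iic t`.
  have key := measure_abs_sum_injTuples_sub_le (m := 1) (n := n) le_rfl hn
    (fun y => if y 0 ≤ t then 1 else 0)
    (Measurable.ite (measurableSet_le (measurable_pi_apply _) measurable_const)
      measurable_const measurable_const)
    (fun y => by split_ifs <;> norm_num) (fun y => by split_ifs <;> norm_num) hε
  have hall : injTuples 1 n = Finset.univ :=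
    Finset.eq_univ_of_forall fun k => mem_injTuples.mpr (Function.injective_of_subsingleton k)
  have hint : ∫ y : Fin 1 → unitInterval, (if y 0 ≤ t then (1 : ℝ) else 0) = t := by
    have hmp := measurePreserving_eval (fun _ : Fin 1 => (volume : Measure unitInterval)) 0
    have : ∫ y : Fin 1 → unitInterval, (if y 0 ≤ t then (1 : ℝ) else 0)
        = ∫ s : unitInterval, (if s ≤ t then (1 : ℝ) else 0) := by
      have hmeas : Measurable fun s : unitInterval => if s ≤ t then (1 : ℝ) else 0 :=
        Measurable.ite (measurableSet_le measurable_id measurable_const)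
          measurable_const measurable_const
      rw [← hmp.map_eq, integral_map hmp.measurable.aemeasurable hmeas.aestronglyMeasurable]
      rfl
    rw [this]
    have h2 : (fun s : unitInterval => if s ≤ t then (1 : ℝ) else 0)
        = (Set.Iic t).indicator fun _ => 1 := by
      funext s
      simp [Set.indicator_apply]
    rw [h2, integral_indicator_const _ measurableSet_Iic, Measure.real, unitInterval.volume_Iic]
    simp [t.2.1]
  have hsum : ∀ x : Fin n → unitInterval,
      ∑ k : Fin 1 → Fin n, (if (x ∘ k) 0 ≤ t then (1 : ℝ) else 0)
        = ((Finset.univ.filter fun i => x i ≤ t).card : ℝ) := by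
    intro x
    rw [← (Equiv.funUnique (Fin 1) (Fin n)).symm.sum_comp]
    simp [Finset.sum_boole]
  rw [hall, hint] at key
  simp only [hsum, pow_one, Finset.card_univ, Fintype.card_pi, Fintype.card_fin,
    Finset.prod_const, Finset.card_univ] at key
  refine key.trans (le_of_eq ?_)
  simp

end Tuples

/-! ### Concentration in the coins for fixed sample points. -/

section Coins

open Classical in
/-- The indicator that all coins of the subsets of `σ` with at least two elements are successful. -/
noncomputable def coinInd {n : ℕ} (β u : Finset (Fin n) → unitInterval) (σ : Finset (Fin n)) : ℝ :=
  if ∀ τ ⊆ σ, 2 ≤ τ.card → u τ ≤ β τ then 1 else 0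

theorem coinInd_nonneg {n : ℕ} (β u : Finset (Fin n) → unitInterval) (σ : Finset (Fin n)) :
    0 ≤ coinInd β u σ := by
  unfold coinInd
  split_ifs <;> norm_num

theorem coinInd_le_one {n : ℕ} (β u : Finset (Fin n) → unitInterval) (σ : Finset (Fin n)) :
    coinInd β u σ ≤ 1 := by
  unfold coinInd
  split_ifs <;> norm_num

theorem measurable_coinInd_of_measurable {n : ℕ} {X : Type*} [MeasurableSpace X]
    {β u : X → Finset (Fin n) → unitInterval} (hβ : ∀ τ, Measurable fun x => β x τ)
    (hu : ∀ τ, Measurable fun x => u x τ) (σ : Finset (Fin n)) :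
    Measurable fun x => coinInd (β x) (u x) σ := by
  refine Measurable.ite ?_ measurable_const measurable_const
  simp only [Set.ofPred_forall]
  exact MeasurableSet.iInter fun τ => MeasurableSet.iInter fun _ => MeasurableSet.iInter fun _ =>
    measurableSet_le (hu τ) (hβ τ)

theorem measurable_coinInd {n : ℕ} (β : Finset (Fin n) → unitInterval) (σ : Finset (Fin n)) :
    Measurable fun u => coinInd β u σ :=
  measurable_coinInd_of_measurable (X := Finset (Fin n) → unitInterval) (β := fun _ => β)
    (u := fun u => u) (fun _ => measurable_const) (fun τ => measurable_pi_apply τ) σ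

/-- The event is a box in the cube of coins: the side is `Iic (β τ)` for the relevant `τ` and
everything otherwise. -/
theorem integral_coinInd {n : ℕ} (β : Finset (Fin n) → unitInterval) (σ : Finset (Fin n)) :
    ∫ u, coinInd β u σ = ∏ τ ∈ σ.powerset.filter (fun τ => 2 ≤ τ.card), (β τ : ℝ) := by
  classical
  set A : Set (Finset (Fin n) → unitInterval) :=
    Set.univ.pi fun τ => if τ ∈ σ.powerset.filter (fun τ => 2 ≤ τ.card) then Set.Iic (β τ)
      else Set.univ with hA
  have hAm : MeasurableSet A := MeasurableSet.univ_pi fun τ => by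
    split_ifs
    · exact measurableSet_Iic
    · exact MeasurableSet.univ
  have h : (fun u => coinInd β u σ) = A.indicator fun _ => (1 : ℝ) := by
    funext u
    rw [coinInd, Set.indicator_apply]
    congr 1
    simp only [hA, Set.mem_univ_pi, Finset.mem_filter, Finset.mem_powerset, eq_iff_iff]
    refine forall_congr' fun τ => ?_
    split_ifs with hτ
    · simp [hτ.1, hτ.2]
    · simp only [Set.mem_univ, iff_true]
      exact fun h1 h2 => absurd ⟨h1, h2⟩ hτ
  rw [h, integral_indicator_const _ hAm, smul_eq_mul, mul_one, Measure.real, hA, volume_pi_pi,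
    ENNReal.toReal_prod]
  rw [← Finset.prod_subset (Finset.subset_univ (σ.powerset.filter fun τ => 2 ≤ τ.card))]
  · refine Finset.prod_congr rfl fun τ hτ => ?_
    rw [if_pos hτ, unitInterval.volume_Iic, ENNReal.toReal_ofReal (β τ).2.1]
  · intro τ _ hτ
    rw [if_neg hτ]
    simp

theorem card_filter_subset_image_mul_le {m n : ℕ} {τ : Finset (Fin n)} (hτ : 2 ≤ τ.card)
    (B : Finset (Fin m → Fin n)) :
    (B.filter fun k => τ ⊆ Finset.univ.image k).card * n ^ 2 ≤ m ^ 2 * n ^ m := by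
  obtain ⟨a, ha, b, hb, hab⟩ := Finset.one_lt_card.mp hτ
  refine le_trans ?_ (card_filter_exists_eq_and_mul_le m hab)
  gcongr
  intro k hk
  have h := (Finset.mem_filter.mp hk).2
  simpa using And.intro (h ha) (h hb)

/-- Double counting: a tuple has an image of at most `m` points, hence at most `2 ^ m` subsets. -/
theorem sum_card_filter_subset_image_le {m n : ℕ} (B : Finset (Fin m → Fin n)) :
    ∑ τ : Finset (Fin n), (B.filter fun k => τ ⊆ Finset.univ.image k).card ≤ 2 ^ m * n ^ m := by
  simp_rw [Finset.card_filter]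
  rw [Finset.sum_comm]
  calc ∑ k ∈ B, ∑ τ : Finset (Fin n), (if τ ⊆ Finset.univ.image k then 1 else 0)
      ≤ ∑ _k ∈ B, 2 ^ m := by
        refine Finset.sum_le_sum fun k _ => ?_
        rw [← Finset.card_filter]
        have : (Finset.univ.filter fun τ => τ ⊆ Finset.univ.image k) = (Finset.univ.image k).powerset := by
          ext τ
          simp
        rw [this, Finset.card_powerset]
        refine Nat.pow_le_pow_right two_pos ?_
        simpa using Finset.card_image_le (s := Finset.univ) (f := k)
    _ ≤ 2 ^ m * n ^ m := by
        rw [Finset.sum_const, smul_eq_mul, mul_comm]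
        gcongr
        simpa using Finset.card_le_univ B

/-- Concentration of the number of tuples of `B` that span a simplex, given the probabilities. -/
theorem measure_abs_sum_coinInd_sub_le {m n : ℕ} (hm : 1 ≤ m) (hn : 1 ≤ n)
    (β : Finset (Fin n) → unitInterval) (B : Finset (Fin m → Fin n)) {ε : ℝ} (hε : 0 ≤ ε) :
    volume {u : Finset (Fin n) → unitInterval | ε * (n : ℝ) ^ m ≤
        |∑ k ∈ B, (coinInd β u (Finset.univ.image k)
          - ∏ τ ∈ (Finset.univ.image k).powerset.filter (fun τ => 2 ≤ τ.card), (β τ : ℝ))|}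
      ≤ ENNReal.ofReal (2 * Real.exp (-(2 * ε ^ 2 / (m ^ 2 * 2 ^ m)) * n ^ 2)) := by
  classical
  have hn' : (0 : ℝ) < n := by exact_mod_cast hn
  have hm' : (0 : ℝ) < m := by exact_mod_cast hm
  set f : (Finset (Fin n) → unitInterval) → ℝ :=
    fun u => ∑ k ∈ B, coinInd β u (Finset.univ.image k) with hf
  have hfm : Measurable f := Finset.measurable_sum _ fun k _ => measurable_coinInd _ _
  have hint : ∫ u, f u = ∑ k ∈ B,
      ∏ τ ∈ (Finset.univ.image k).powerset.filter (fun τ => 2 ≤ τ.card), (β τ : ℝ) := by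
    rw [hf, integral_finsetSum _ fun k _ => Integrable.of_bound
      (measurable_coinInd _ _).aestronglyMeasurable 1 (ae_of_all _ fun x => by
        rw [Real.norm_eq_abs, abs_of_nonneg (coinInd_nonneg _ _ _)]; exact coinInd_le_one _ _ _)]
    exact Finset.sum_congr rfl fun k _ => integral_coinInd _ _
  have hfM : ∀ u, |f u| ≤ B.card := by
    intro x
    rw [abs_of_nonneg (Finset.sum_nonneg fun k _ => coinInd_nonneg _ _ _)]
    calc f x ≤ ∑ k ∈ B, (1 : ℝ) := Finset.sum_le_sum fun k _ => coinInd_le_one _ _ _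
      _ = _ := by simp
  -- The coin of `τ` matters only for tuples whose image contains `τ`; coins of sets with fewer than
  -- two elements are never read.
  set c : Finset (Fin n) → NNReal := fun τ => if 2 ≤ τ.card then
    ((B.filter fun k => τ ⊆ Finset.univ.image k).card : NNReal) else 0 with hc
  have hdiff : ∀ (τ : Finset (Fin n)) (u : Finset (Fin n) → unitInterval) (a : unitInterval),
      |f (Function.update u τ a) - f u| ≤ c τ := by
    intro τ u a
    have hk : ∀ k ∈ B, |coinInd β (Function.update u τ a) (Finset.univ.image k)
        - coinInd β u (Finset.univ.image k)|
        ≤ if 2 ≤ τ.card ∧ τ ⊆ Finset.univ.image k then (1 : ℝ) else 0 := by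
      intro k _
      split_ifs with hs
      · rw [abs_le]
        constructor <;> linarith [coinInd_nonneg β (Function.update u τ a) (Finset.univ.image k),
          coinInd_le_one β (Function.update u τ a) (Finset.univ.image k),
          coinInd_nonneg β u (Finset.univ.image k), coinInd_le_one β u (Finset.univ.image k)]
      · have : coinInd β (Function.update u τ a) (Finset.univ.image k)
            = coinInd β u (Finset.univ.image k) := by
          unfold coinInd
          congr 1
          rw [eq_iff_iff]
          refine forall_congr' fun ρ => forall_congr' fun h1 => forall_congr' fun h2 => ?_
          rw [Function.update_of_ne]
          rintro rfl
          exact hs ⟨h2, h1⟩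
        rw [this]
        simp
    simp only [hf]
    rw [← Finset.sum_sub_distrib]
    refine (Finset.abs_sum_le_sum_abs _ _).trans ((Finset.sum_le_sum hk).trans (le_of_eq ?_))
    by_cases h2 : 2 ≤ τ.card
    · simp [hc, h2]
    · simp [hc, h2]
  have hc1 : ∀ τ, (c τ : ℝ) ≤ m ^ 2 * (n : ℝ) ^ m / n ^ 2 := by
    intro τ
    simp only [hc]
    split_ifs with h
    · rw [le_div_iff₀ (by positivity)]
      exact_mod_cast card_filter_subset_image_mul_le h B
    · simp only [NNReal.coe_zero]
      positivity
  have hc2 : ∑ τ, (c τ : ℝ) ≤ 2 ^ m * (n : ℝ) ^ m := by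
    calc ∑ τ, (c τ : ℝ)
        ≤ ∑ τ : Finset (Fin n), ((B.filter fun k => τ ⊆ Finset.univ.image k).card : ℝ) := by
          refine Finset.sum_le_sum fun τ _ => ?_
          simp only [hc]
          split_ifs
          · simp
          · simp
      _ ≤ _ := by exact_mod_cast sum_card_filter_subset_image_le B
  -- `V` bounds the sum of squares by maximum times sum. It is of order `n ^ (2 * m - 2)`, whence
  -- the `n ^ 2` in the exponent.
  have key := measure_abs_ge_le_of_bounded_differences (volume : Measure unitInterval) f hfm _ hfM c
    hdiff (V := (m ^ 2 * (n : ℝ) ^ m / n ^ 2) * (2 ^ m * (n : ℝ) ^ m)) (by positivity) (by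
      calc ∑ τ, (c τ : ℝ) ^ 2 ≤ ∑ τ, (m ^ 2 * (n : ℝ) ^ m / n ^ 2) * c τ := by
            refine Finset.sum_le_sum fun τ _ => ?_
            rw [sq]
            exact mul_le_mul_of_nonneg_right (hc1 τ) (c τ).2
        _ ≤ _ := by
            rw [← Finset.mul_sum]
            gcongr) (ε := ε * (n : ℝ) ^ m) (by positivity)
  rw [← volume_pi, hint] at key
  simp only [hf, ← Finset.sum_sub_distrib] at key
  refine key.trans (le_of_eq ?_)
  congr 3
  field_simp

end Coins

/-! ### Interval exchanges permuting the pixels. -/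

section IntervalExchange

/-- The index of the pixel containing `t`; the point `1` is assigned to the last pixel. -/
noncomputable def pixelIndex {n : ℕ} (hn : 1 ≤ n) (t : unitInterval) : Fin n :=
  ⟨min ⌊(n : ℝ) * t⌋₊ (n - 1), by omega⟩

/-- The half-open pixels miss the point 1, which the index assigns to the last pixel; hence the
exclusion, harmless up to a null set. -/
theorem pixelIndex_eq_iff {n : ℕ} (hn : 1 ≤ n) {t : unitInterval} (ht : t ≠ 1) (j : Fin n) :
    pixelIndex hn t = j ↔ t ∈ Complexon.pixel n j := by
  have hn' : (0 : ℝ) < n := by exact_mod_cast hn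
  have ht1 : (t : ℝ) < 1 := lt_of_le_of_ne t.2.2 fun h => ht (Subtype.ext h)
  have hnt : 0 ≤ (n : ℝ) * t := mul_nonneg hn'.le t.2.1
  have hfl : ⌊(n : ℝ) * t⌋₊ < n := by
    rw [Nat.floor_lt hnt]
    nlinarith
  rw [Fin.ext_iff]
  change min ⌊(n : ℝ) * t⌋₊ (n - 1) = (j : ℕ) ↔ _
  rw [min_eq_left (by omega), Nat.floor_eq_iff hnt]
  simp only [Complexon.pixel, Set.mem_ofPred_eq]
  rw [div_le_iff₀ hn', lt_div_iff₀ hn', mul_comm]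

theorem measurable_pixelIndex {n : ℕ} (hn : 1 ≤ n) : Measurable (pixelIndex hn) := by
  have h1 : Measurable fun t : unitInterval => ⌊(n : ℝ) * t⌋₊ :=
    Nat.measurable_floor.comp (measurable_subtype_coe.const_mul _)
  have h2 : Measurable fun i : ℕ => (⟨min i (n - 1), by omega⟩ : Fin n) := measurable_from_top
  exact h2.comp h1

theorem abs_sub_pixelIndex_le {n : ℕ} (hn : 1 ≤ n) (t : unitInterval) :
    ((pixelIndex hn t : ℕ) : ℝ) / n ≤ t ∧ (t : ℝ) ≤ ((pixelIndex hn t : ℕ) + 1) / n := by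
  have hn' : (0 : ℝ) < n := by exact_mod_cast hn
  rcases eq_or_ne t 1 with rfl | ht
  · have : ((pixelIndex hn 1 : ℕ)) = n - 1 := by simp [pixelIndex]
    rw [this, Nat.cast_sub hn, div_le_iff₀ hn', le_div_iff₀ hn']
    simp
  · have := (pixelIndex_eq_iff hn ht _).mp rfl
    exact ⟨this.1, this.2.le⟩

/-- The interval exchange that moves the `j`-th pixel onto the `π j`-th pixel. -/
noncomputable def pixelExchange {n : ℕ} (hn : 1 ≤ n) (π : Equiv.Perm (Fin n)) (t : unitInterval) :
    unitInterval :=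
  ⟨t + (((π (pixelIndex hn t) : ℕ) : ℝ) - (pixelIndex hn t : ℕ)) / n, by
    have hn' : (0 : ℝ) < n := by exact_mod_cast hn
    obtain ⟨h1, h2⟩ := abs_sub_pixelIndex_le hn t
    have h3 : (((π (pixelIndex hn t) : ℕ) : ℝ) + 1) ≤ n := by
      exact_mod_cast (π (pixelIndex hn t)).2
    have h4 : (0 : ℝ) ≤ ((π (pixelIndex hn t) : ℕ) : ℝ) := Nat.cast_nonneg _
    rw [div_le_iff₀ hn'] at h1
    rw [le_div_iff₀ hn'] at h2
    constructor
    · have : 0 ≤ ((t : ℝ) * n + (((π (pixelIndex hn t) : ℕ) : ℝ) - (pixelIndex hn t : ℕ))) / n := by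
        apply div_nonneg _ hn'.le
        linarith
      rwa [add_div, mul_div_cancel_right₀ _ hn'.ne'] at this
    · have : ((t : ℝ) * n + (((π (pixelIndex hn t) : ℕ) : ℝ) - (pixelIndex hn t : ℕ))) / n ≤ 1 := by
        rw [div_le_one hn']
        linarith
      rwa [add_div, mul_div_cancel_right₀ _ hn'.ne'] at this⟩

theorem measurable_pixelExchange {n : ℕ} (hn : 1 ≤ n) (π : Equiv.Perm (Fin n)) :
    Measurable (pixelExchange hn π) := by
  refine Measurable.subtype_mk ?_
  have : Measurable fun j : Fin n => (((π j : ℕ) : ℝ) - (j : ℕ)) / n := measurable_from_top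
  exact measurable_subtype_coe.add (this.comp (measurable_pixelIndex hn))

theorem pixelExchange_mem_pixel_iff {n : ℕ} (hn : 1 ≤ n) (π : Equiv.Perm (Fin n)) {t : unitInterval}
    (ht : t ≠ 1) (j : Fin n) :
    pixelExchange hn π t ∈ Complexon.pixel n j ↔ π (pixelIndex hn t) = j := by
  have hn' : (0 : ℝ) < n := by exact_mod_cast hn
  have hmem := (pixelIndex_eq_iff hn ht _).mp rfl
  have h1 : pixelExchange hn π t ∈ Complexon.pixel n (π (pixelIndex hn t)) := by
    simp only [Complexon.pixel, Set.mem_ofPred_eq, pixelExchange] at hmem ⊢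
    constructor
    · have := hmem.1
      rw [sub_div]
      linarith
    · have := hmem.2
      rw [add_div] at this ⊢
      rw [sub_div]
      linarith
  have hne : pixelExchange hn π t ≠ 1 := by
    intro h
    have h2 := h1.2
    rw [h, lt_div_iff₀ hn'] at h2
    have h3 : (((π (pixelIndex hn t) : ℕ) : ℝ) + 1) ≤ n := by
      exact_mod_cast (π (pixelIndex hn t)).2
    simp only [Set.Icc.coe_one, one_mul] at h2
    linarith
  rw [← pixelIndex_eq_iff hn hne] at h1 ⊢
  rw [h1]

theorem image_coe_pixel {n : ℕ} (j : Fin n) :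
    Subtype.val '' Complexon.pixel n j = Set.Ico (((j : ℕ) : ℝ) / n) ((((j : ℕ) : ℝ) + 1) / n) := by
  have hn' : (0 : ℝ) < n := by exact_mod_cast j.pos
  have h3 : (((j : ℕ) : ℝ) + 1) ≤ n := by exact_mod_cast j.2
  ext t
  constructor
  · rintro ⟨s, hs, rfl⟩
    exact hs
  · rintro ⟨h1, h2⟩
    refine ⟨⟨t, le_trans (by positivity) h1, h2.le.trans ?_⟩, ⟨h1, h2⟩, rfl⟩
    rwa [div_le_one hn']

theorem volume_pixel {n : ℕ} (j : Fin n) :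
    volume (Complexon.pixel n j) = ENNReal.ofReal (1 / n) := by
  rw [unitInterval.volume_apply, image_coe_pixel, Real.volume_Ico]
  congr 1
  ring

theorem volume_singleton_one_unitInterval : volume ({1} : Set unitInterval) = 0 := by
  rw [unitInterval.volume_apply]
  simp

theorem volume_eq_sum_inter_pixel {n : ℕ} (hn : 1 ≤ n) {A : Set unitInterval}
    (hA : MeasurableSet A) : volume A = ∑ j, volume (A ∩ Complexon.pixel n j) := by
  have hdisj : Pairwise (Function.onFun Disjoint fun j : Fin n => A ∩ Complexon.pixel n j) := by
    intro i j hij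
    refine Set.disjoint_left.mpr fun t hi hj => hij ?_
    have ht : t ≠ 1 := by
      rintro rfl
      have hn' : (0 : ℝ) < n := by exact_mod_cast hn
      have h2 := hi.2.2
      rw [lt_div_iff₀ hn'] at h2
      have h3 : (((i : ℕ) : ℝ) + 1) ≤ n := by exact_mod_cast i.2
      simp only [Set.Icc.coe_one, one_mul] at h2
      linarith
    rw [← (pixelIndex_eq_iff hn ht i).mpr hi.2, (pixelIndex_eq_iff hn ht j).mpr hj.2]
  rw [← tsum_fintype (L := .unconditional _), ← measure_iUnion hdisj fun j =>
    hA.inter (Complexon.measurableSet_pixel n j)]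
  refine measure_congr ?_
  have hne : ∀ᵐ t : unitInterval, t ≠ 1 := by
    rw [ae_iff]
    simp
  filter_upwards [hne] with t ht
  refine propext ⟨fun h => ?_, fun h => ?_⟩
  · exact Set.mem_iUnion.mpr ⟨pixelIndex hn t, h, (pixelIndex_eq_iff hn ht _).mp rfl⟩
  · obtain ⟨j, hj⟩ := Set.mem_iUnion.mp h
    exact hj.1

/-- On the `j`-th pixel the exchange is a translation, so this is translation invariance of Lebesgue
measure on the line. -/
theorem volume_preimage_pixelExchange_inter {n : ℕ} (hn : 1 ≤ n) (π : Equiv.Perm (Fin n))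
    (A : Set unitInterval) (j : Fin n) :
    volume (pixelExchange hn π ⁻¹' A ∩ Complexon.pixel n j)
      = volume (A ∩ Complexon.pixel n (π j)) := by
  have hn' : (0 : ℝ) < n := by exact_mod_cast hn
  have hne1 : ∀ (i : Fin n) (t : unitInterval), t ∈ Complexon.pixel n i → t ≠ 1 := by
    rintro i t hi rfl
    have h2 := hi.2
    rw [lt_div_iff₀ hn'] at h2
    have h3 : (((i : ℕ) : ℝ) + 1) ≤ n := by exact_mod_cast i.2
    simp only [Set.Icc.coe_one, one_mul] at h2
    linarith
  rw [unitInterval.volume_apply, unitInterval.volume_apply,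
    ← measure_preimage_add_right volume ((((π j : ℕ) : ℝ) - (j : ℕ)) / n)
      (Subtype.val '' (A ∩ Complexon.pixel n (π j)))]
  congr 1
  ext s
  constructor
  · rintro ⟨t, ⟨htA, ht⟩, rfl⟩
    have hidx := (pixelIndex_eq_iff hn (hne1 j t ht) j).mpr ht
    refine ⟨pixelExchange hn π t, ⟨htA, ?_⟩, ?_⟩
    · rw [pixelExchange_mem_pixel_iff hn π (hne1 j t ht), hidx]
    · simp [pixelExchange, hidx]
  · rintro ⟨t, ⟨htA, ht⟩, hts⟩
    have hs : s ∈ Set.Ico (((j : ℕ) : ℝ) / n) ((((j : ℕ) : ℝ) + 1) / n) := by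
      have h1 := ht.1
      have h2 := ht.2
      rw [hts] at h1 h2
      rw [sub_div] at h1 h2
      rw [add_div] at h2
      constructor
      · linarith
      · rw [add_div]
        linarith
    rw [← image_coe_pixel] at hs
    obtain ⟨r, hr, rfl⟩ := hs
    have hidx := (pixelIndex_eq_iff hn (hne1 j r hr) j).mpr hr
    refine ⟨r, ⟨?_, hr⟩, rfl⟩
    have : pixelExchange hn π r = t := by
      apply Subtype.ext
      rw [hts]
      simp [pixelExchange, hidx]
    simpa [this] using htA

theorem measurePreserving_pixelExchange {n : ℕ} (hn : 1 ≤ n) (π : Equiv.Perm (Fin n)) :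
    MeasurePreserving (pixelExchange hn π) volume volume := by
  refine ⟨measurable_pixelExchange hn π, ?_⟩
  ext A hA
  rw [Measure.map_apply (measurable_pixelExchange hn π) hA,
    volume_eq_sum_inter_pixel hn (measurable_pixelExchange hn π hA),
    volume_eq_sum_inter_pixel hn hA]
  simp_rw [volume_preimage_pixelExchange_inter]
  exact Equiv.sum_comp π fun j => volume (A ∩ Complexon.pixel n j)

end IntervalExchange

/-! ### Evaluating the integrals and complexons pixel by pixel. -/

section Evaluation

/-- The integrand depends only on the indices, whose law under the restricted product measure is a
product of finite discrete measures. -/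
theorem setIntegral_pi_comp_index {m n : ℕ} (idx : unitInterval → Fin n) (hidx : Measurable idx)
    (S : Fin m → Set unitInterval) (G : (Fin m → Fin n) → ℝ) :
    ∫ y in Set.univ.pi S, G (fun l => idx (y l))
      = ∑ k, (∏ l, volume.real (idx ⁻¹' {k l} ∩ S l)) * G k := by
  have hm : Measurable fun (y : Fin m → unitInterval) l => idx (y l) :=
    measurable_pi_lambda _ fun l => hidx.comp (measurable_pi_apply l)
  rw [volume_pi, Measure.restrict_pi_pi]
  refine (integral_map (f := G) hm.aemeasurable
    (measurable_of_finite G).aestronglyMeasurable).symm.trans ?_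
  rw [Measure.pi_map_pi (fun l => hidx.aemeasurable), integral_fintype (Integrable.of_finite)]
  refine Finset.sum_congr rfl fun k _ => ?_
  rw [Measure.real, Measure.pi_singleton, ENNReal.toReal_prod, smul_eq_mul]
  congr 1
  refine Finset.prod_congr rfl fun l _ => ?_
  rw [Measure.map_apply hidx (MeasurableSet.singleton _),
    Measure.restrict_apply (hidx (MeasurableSet.singleton _))]
  rfl

theorem measureReal_pixelIndex_preimage_le {n : ℕ} (hn : 1 ≤ n) (j : Fin n) :
    volume.real (pixelIndex hn ⁻¹' {j}) ≤ 1 / n := by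
  have hsub : pixelIndex hn ⁻¹' {j} ⊆ Complexon.pixel n j ∪ {1} := by
    intro t ht
    rcases eq_or_ne t 1 with rfl | h
    · exact Or.inr rfl
    · exact Or.inl ((pixelIndex_eq_iff hn h j).mp ht)
  have h : volume (pixelIndex hn ⁻¹' {j}) ≤ ENNReal.ofReal (1 / n) := by
    refine (measure_mono hsub).trans ((measure_union_le _ _).trans ?_)
    rw [volume_pixel, volume_singleton_one_unitInterval, add_zero]
  exact ENNReal.toReal_le_of_le_ofReal (by positivity) h

/-- Subsets of the index set correspond to subsets of the image, and those of size at most 1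
contribute factors 1. This matches the product in `integral_coinInd`: the faceted value is the
conditional probability of the simplex. -/
theorem Complexon.faceted_comp_of_injective (W : Complexon) {m n : ℕ} (x : Fin n → unitInterval)
    {k : Fin m → Fin n} (hk : Function.Injective k) :
    (W.faceted.toFun m (x ∘ k) : ℝ)
      = ∏ τ ∈ (Finset.univ.image k).powerset.filter (fun τ => 2 ≤ τ.card), (W.onFace x τ : ℝ) := by
  have hface : ∀ ρ : Finset (Fin m), W.onFace (x ∘ k) ρ = W.onFace x (ρ.image k) := by
    intro ρ
    refine W.toFun_comp_of_injective x (fun i => k (ρ.orderEmbOfFin rfl i))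
      (hk.comp (ρ.orderEmbOfFin rfl).injective) _ ?_
    rw [show (fun i => k (ρ.orderEmbOfFin rfl i)) = k ∘ ρ.orderEmbOfFin rfl from rfl,
      ← Finset.image_image, Finset.image_orderEmbOfFin_univ]
  have hcoe : ∀ s : Finset (Finset (Fin m)), ((∏ ρ ∈ s, W.onFace (x ∘ k) ρ : unitInterval) : ℝ)
      = ∏ ρ ∈ s, (W.onFace x (ρ.image k) : ℝ) := by
    intro s
    induction s using Finset.cons_induction with
    | empty => simp
    | cons a s ha ih => simp only [Finset.prod_cons, Set.Icc.coe_mul, ih]; rw [hface]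
  change ((∏ ρ : Finset (Fin m), W.onFace (x ∘ k) ρ : unitInterval) : ℝ) = _
  rw [hcoe, Finset.prod_filter_of_ne]
  · have himg : (Finset.univ.image k).powerset
        = (Finset.univ : Finset (Finset (Fin m))).image fun ρ => ρ.image k := by
      ext τ
      simp only [Finset.mem_powerset, Finset.mem_image, Finset.mem_univ, true_and]
      constructor
      · intro h
        obtain ⟨ρ, -, rfl⟩ := Finset.subset_image_iff.mp h
        exact ⟨ρ, rfl⟩
      · rintro ⟨ρ, rfl⟩
        exact Finset.image_subset_image (Finset.subset_univ _)
    rw [himg, Finset.prod_image]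
    exact fun a _ b _ h => Finset.image_injective hk h
  · intro τ _ hτ
    by_contra h
    refine hτ ?_
    rw [Complexon.onFace, W.eq_one_of_le _ _ (by omega)]
    rfl

open Classical in
theorem Complexon.ofComplex_sample_pullback_apply (W : Complexon) {m n : ℕ} (hm : 2 ≤ m)
    (hn : 1 ≤ n) (x : Fin n → unitInterval) (u : Finset (Fin n) → unitInterval)
    (π : Equiv.Perm (Fin n)) {y : Fin m → unitInterval} (hy : ∀ l, y l ≠ 1) :
    ((((Complexon.ofComplex (W.sample n (x, u))).pullback (pixelExchange hn π)
        (measurable_pixelExchange hn π)).toFun m y : unitInterval) : ℝ)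
      = if Function.Injective (fun l => π (pixelIndex hn (y l))) then
          coinInd (fun σ => W.onFace x σ) u (Finset.univ.image fun l => π (pixelIndex hn (y l)))
        else 0 := by
  have hmem : pixelExchange hn π ∘ y ∈ Complexon.pixelSet (W.sample n (x, u)) m ↔
      Function.Injective (fun l => π (pixelIndex hn (y l))) ∧
        (Finset.univ.image fun l => π (pixelIndex hn (y l))) ∈ (W.sample n (x, u)).faces := by
    constructor
    · rintro ⟨j, hj, hK, h⟩
      have : j = fun l => π (pixelIndex hn (y l)) := by
        funext l
        exact ((pixelExchange_mem_pixel_iff hn π (hy l) _).mp (h l)).symm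
      exact this ▸ ⟨hj, hK⟩
    · rintro ⟨hj, hK⟩
      exact ⟨_, hj, hK, fun l => (pixelExchange_mem_pixel_iff hn π (hy l) _).mpr rfl⟩
  have hface : ∀ σ : Finset (Fin n), σ.Nonempty → (σ ∈ (W.sample n (x, u)).faces ↔
      ∀ τ ⊆ σ, 2 ≤ τ.card → u τ ≤ W.onFace x τ) := by
    intro σ hσ
    exact (isSampled_iff _ _ _).trans (and_iff_right hσ)
  have hne : (Finset.univ.image fun l => π (pixelIndex hn (y l))).Nonempty :=
    ⟨_, Finset.mem_image_of_mem _ (Finset.mem_univ ⟨0, by omega⟩)⟩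
  change (((if m ≤ 1 ∨ pixelExchange hn π ∘ y ∈ Complexon.pixelSet (W.sample n (x, u)) m
    then 1 else 0 : unitInterval)) : ℝ) = _
  rw [hmem, hface _ hne]
  by_cases h1 : Function.Injective (fun l => π (pixelIndex hn (y l)))
  · simp only [h1, true_and, if_true, coinInd, show ¬ m ≤ 1 by omega, false_or]
    split_ifs <;> rfl
  · simp [h1, show ¬ m ≤ 1 by omega]

end Evaluation

/-! ### The deterministic cut-norm estimate. -/

section Deterministic

open Classical in
-- Collects the error terms for a fixed sample: L¹ approximation, displacement of the points, the
-- U-statistic of `|H - g|`, non-injective tuples, and the coins. The bound is uniform in `S`.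
theorem Complexon.abs_setIntegral_faceted_sub_le (W : Complexon) {m n : ℕ} (hm : 2 ≤ m)
    (hn : 1 ≤ n) (x : Fin n → unitInterval) (u : Finset (Fin n) → unitInterval)
    (π : Equiv.Perm (Fin n)) (g : (Fin m → unitInterval) → ℝ) (hg : Measurable g)
    (hg0 : ∀ y, 0 ≤ g y) (hg1 : ∀ y, g y ≤ 1) {η C : ℝ}
    (hη : ∀ y : Fin m → unitInterval, |g y - g fun l => x (π (pixelIndex hn (y l)))| ≤ η)
    (hC : ∀ S : Fin m → Finset (Fin n),
      |∑ k ∈ (injTuples m n).filter (fun k => ∀ l, k l ∈ S l),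
        (coinInd (fun σ => W.onFace x σ) u (Finset.univ.image k) - W.faceted.toFun m (x ∘ k))|
        ≤ C * (n : ℝ) ^ m)
    (S : Fin m → Set unitInterval) :
    |∫ y in Set.univ.pi S, ((W.faceted.toFun m y : ℝ)
        - (((Complexon.ofComplex (W.sample n (x, u))).pullback (pixelExchange hn π)
          (measurable_pixelExchange hn π)).toFun m y : unitInterval))|
      ≤ (∫ y, |(W.faceted.toFun m y : ℝ) - g y|) + η
        + (∑ k ∈ injTuples m n, |(W.faceted.toFun m (x ∘ k) : ℝ) - g (x ∘ k)|) / (n : ℝ) ^ m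
        + m ^ 2 / n + C := by
  have hn' : (0 : ℝ) < n := by exact_mod_cast hn
  set H : (Fin m → unitInterval) → ℝ := fun y => (W.faceted.toFun m y : ℝ) with hH
  have hHm : Measurable H := measurable_subtype_coe.comp (W.faceted.measurable_toFun m)
  set idx : unitInterval → Fin n := fun t => π (pixelIndex hn t) with hidx
  have hidxm : Measurable idx := (measurable_of_finite π).comp (measurable_pixelIndex hn)
  set J : (Fin m → Fin n) → ℝ := fun k => if Function.Injective k then
    coinInd (fun σ => W.onFace x σ) u (Finset.univ.image k) else 0 with hJ
  set G : (Fin m → Fin n) → ℝ := fun k => g (x ∘ k) - J k with hG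
  have hdiff1 : Integrable (fun y => |H y - g y|) := by
    refine Integrable.of_bound (hHm.sub hg).abs.aestronglyMeasurable 1 (ae_of_all _ fun y => ?_)
    rw [Real.norm_eq_abs, abs_abs, abs_le]
    have h1 := (W.faceted.toFun m y).2
    constructor <;> linarith [h1.1, h1.2, hg0 y, hg1 y]
  have hcompm : Measurable fun y : Fin m → unitInterval => fun l => idx (y l) :=
    measurable_pi_lambda _ fun l => hidxm.comp (measurable_pi_apply l)
  have hGm : Measurable fun y : Fin m → unitInterval => G fun l => idx (y l) :=
    (measurable_of_finite G).comp hcompm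
  have hne : ∀ᵐ y : Fin m → unitInterval, ∀ l, y l ≠ 1 := by
    rw [ae_all_iff]
    intro l
    have h1 : ∀ᵐ t : unitInterval, t ≠ 1 := by
      rw [ae_iff]
      simp
    exact (measurePreserving_eval (fun _ : Fin m => (volume : Measure unitInterval))
      l).quasiMeasurePreserving.ae h1
  have hae : ∀ᵐ y ∂((volume : Measure (Fin m → unitInterval)).restrict (Set.univ.pi S)),
      H y - (((Complexon.ofComplex (W.sample n (x, u))).pullback (pixelExchange hn π)
          (measurable_pixelExchange hn π)).toFun m y : unitInterval)
        = (H y - g y + (g y - g fun l => x (idx (y l)))) + G fun l => idx (y l) := by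
    filter_upwards [ae_restrict_of_ae hne] with y hy
    rw [W.ofComplex_sample_pullback_apply hm hn x u π hy]
    simp only [hG, hJ, hidx, Function.comp_def]
    ring
  have hR : Measurable fun y : Fin m → unitInterval =>
      H y - g y + (g y - g fun l => x (idx (y l))) := by
    have : Measurable fun y : Fin m → unitInterval => g fun l => x (idx (y l)) :=
      (measurable_of_finite fun k : Fin m → Fin n => g fun l => x (k l)).comp hcompm
    exact (hHm.sub hg).add (hg.sub this)
  have hη0 : 0 ≤ η := (abs_nonneg _).trans (hη fun _ => 0)
  have hRb : ∀ y, ‖H y - g y + (g y - g fun l => x (idx (y l)))‖ ≤ |H y - g y| + η := fun y =>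
    (norm_add_le _ _).trans (add_le_add le_rfl (hη y))
  have hbnd : Integrable (fun y => |H y - g y| + η) := hdiff1.add (integrable_const _)
  have hRi : Integrable fun y : Fin m → unitInterval =>
      H y - g y + (g y - g fun l => x (idx (y l))) :=
    hbnd.mono' hR.aestronglyMeasurable (ae_of_all _ hRb)
  have hGi : Integrable fun y : Fin m → unitInterval => G fun l => idx (y l) := by
    obtain ⟨M, hM⟩ := (Set.finite_range fun k => ‖G k‖).bddAbove
    exact Integrable.of_bound hGm.aestronglyMeasurable M (ae_of_all _ fun y => hM ⟨_, rfl⟩)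
  rw [integral_congr_ae hae, integral_add hRi.restrict hGi.restrict]
  have hpart1 : |∫ y in Set.univ.pi S, (H y - g y + (g y - g fun l => x (idx (y l))))|
      ≤ (∫ y, |H y - g y|) + η := by
    calc |∫ y in Set.univ.pi S, (H y - g y + (g y - g fun l => x (idx (y l))))|
        ≤ ∫ y in Set.univ.pi S, (|H y - g y| + η) :=
          norm_integral_le_of_norm_le hbnd.restrict (ae_of_all _ hRb)
      _ ≤ ∫ y, (|H y - g y| + η) := setIntegral_le_integral hbnd
          (ae_of_all _ fun y => add_nonneg (abs_nonneg _) hη0)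
      _ = _ := by
          rw [integral_add hdiff1 (integrable_const _)]
          simp
  -- Pixels have measure `1 / n`, so the factor `n` turns the measures into weights in `[0,1]`.
  set w : Fin m → Fin n → ℝ := fun l i => n * volume.real (idx ⁻¹' {i} ∩ S l) with hw
  have hw01 : ∀ l i, 0 ≤ w l i ∧ w l i ≤ 1 := by
    intro l i
    refine ⟨mul_nonneg hn'.le measureReal_nonneg, ?_⟩
    have hpre : idx ⁻¹' {i} = pixelIndex hn ⁻¹' {π.symm i} := by
      ext t
      simp [hidx, Equiv.eq_symm_apply]
    have : volume.real (idx ⁻¹' {i} ∩ S l) ≤ 1 / n := by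
      refine (measureReal_mono Set.inter_subset_left).trans ?_
      rw [hpre]
      exact measureReal_pixelIndex_preimage_le hn _
    calc w l i ≤ n * (1 / n) := by simp only [hw]; gcongr
      _ = 1 := by field_simp
  -- The pure coin error, extended by 0. In `G + G2` the coin indicators cancel, leaving `g - H` on
  -- injective tuples and `g` on the others.
  set G2 : (Fin m → Fin n) → ℝ := fun k => if k ∈ injTuples m n then
    coinInd (fun σ => W.onFace x σ) u (Finset.univ.image k) - H (x ∘ k) else 0 with hG2
  have hG2le : |∑ k, (∏ l, w l (k l)) * G2 k| ≤ C * (n : ℝ) ^ m := by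
    refine abs_sum_prod_mul_le_of_forall_finset G2 (fun T => ?_) w hw01
    have : ∑ k ∈ Finset.univ.filter (fun k : Fin m → Fin n => ∀ l, k l ∈ T l), G2 k
        = ∑ k ∈ (injTuples m n).filter (fun k => ∀ l, k l ∈ T l),
          (coinInd (fun σ => W.onFace x σ) u (Finset.univ.image k) - H (x ∘ k)) := by
      simp only [hG2]
      rw [← Finset.sum_filter, Finset.filter_comm]
      congr 1
      ext k
      simp
    rw [this]
    exact hC T
  have hD : ∀ k, |(∏ l, w l (k l)) * (G k + G2 k)|
      ≤ if k ∈ injTuples m n then |H (x ∘ k) - g (x ∘ k)| else 1 := by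
    intro k
    have hp0 : 0 ≤ ∏ l, w l (k l) := Finset.prod_nonneg fun l _ => (hw01 l _).1
    have hp1 : ∏ l, w l (k l) ≤ 1 := Finset.prod_le_one (fun l _ => (hw01 l _).1)
      fun l _ => (hw01 l _).2
    have hsum : |G k + G2 k| ≤ if k ∈ injTuples m n then |H (x ∘ k) - g (x ∘ k)| else 1 := by
      simp only [hG, hJ, hG2, mem_injTuples]
      split_ifs with h
      · rw [abs_sub_comm]
        refine le_of_eq (congrArg _ ?_)
        ring
      · rw [sub_zero, add_zero, abs_of_nonneg (hg0 _)]
        exact hg1 _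
    rw [abs_mul, abs_of_nonneg hp0]
    calc (∏ l, w l (k l)) * |G k + G2 k| ≤ 1 * |G k + G2 k| := by gcongr
      _ ≤ _ := by rwa [one_mul]
  have hDsum : |∑ k, (∏ l, w l (k l)) * (G k + G2 k)|
      ≤ (∑ k ∈ injTuples m n, |H (x ∘ k) - g (x ∘ k)|) + m ^ 2 * (n : ℝ) ^ m / n := by
    refine (Finset.abs_sum_le_sum_abs _ _).trans ((Finset.sum_le_sum fun k _ => hD k).trans ?_)
    rw [← Finset.sum_add_sum_compl (injTuples m n)]
    refine add_le_add (le_of_eq (Finset.sum_congr rfl fun k hk => if_pos hk)) ?_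
    rw [Finset.sum_congr rfl fun k hk => if_neg (Finset.mem_compl.mp hk), Finset.sum_const,
      nsmul_eq_mul, mul_one]
    exact card_compl_injTuples_le m hn
  have hpart2 : |∫ y in Set.univ.pi S, G fun l => idx (y l)|
      ≤ (∑ k ∈ injTuples m n, |H (x ∘ k) - g (x ∘ k)|) / (n : ℝ) ^ m + m ^ 2 / n + C := by
    rw [setIntegral_pi_comp_index idx hidxm S G]
    have hscale : ∑ k, (∏ l, volume.real (idx ⁻¹' {k l} ∩ S l)) * G k
        = (∑ k, (∏ l, w l (k l)) * G k) / (n : ℝ) ^ m := by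
      rw [Finset.sum_div]
      refine Finset.sum_congr rfl fun k _ => ?_
      simp only [hw, Finset.prod_mul_distrib, Finset.prod_const, Finset.card_univ, Fintype.card_fin]
      field_simp
    have hsplit : ∑ k, (∏ l, w l (k l)) * G k
        = ∑ k, (∏ l, w l (k l)) * (G k + G2 k) - ∑ k, (∏ l, w l (k l)) * G2 k := by
      rw [← Finset.sum_sub_distrib]
      exact Finset.sum_congr rfl fun k _ => by ring
    rw [hscale, abs_div, abs_of_pos (show (0 : ℝ) < (n : ℝ) ^ m by positivity),
      div_le_iff₀ (by positivity), hsplit]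
    refine (abs_sub _ _).trans ((add_le_add hDsum hG2le).trans (le_of_eq ?_))
    field_simp
  refine (abs_add_le _ _).trans ((add_le_add hpart1 hpart2).trans (le_of_eq ?_))
  ring

end Deterministic

/-! ### Order statistics and the empirical distribution function. -/

section Sorting

theorem le_card_filter_of_le_sort {n : ℕ} (x : Fin n → unitInterval) (k : Fin n) {s : unitInterval}
    (h : x (Tuple.sort x k) ≤ s) : (k : ℕ) + 1 ≤ (Finset.univ.filter fun i => x i ≤ s).card := by
  rw [← Fin.card_Iic, ← Finset.card_map (s := Finset.Iic k) (Tuple.sort x).toEmbedding]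
  refine Finset.card_le_card fun i hi => ?_
  obtain ⟨j, hj, rfl⟩ := Finset.mem_map.mp hi
  exact Finset.mem_filter.mpr ⟨Finset.mem_univ _,
    (Tuple.monotone_sort x (Finset.mem_Iic.mp hj)).trans h⟩

theorem card_filter_le_of_lt_sort {n : ℕ} (x : Fin n → unitInterval) (k : Fin n) {s : unitInterval}
    (h : s < x (Tuple.sort x k)) : (Finset.univ.filter fun i => x i ≤ s).card ≤ (k : ℕ) := by
  rw [← Fin.card_Iio, ← Finset.card_map (s := Finset.Iio k) (Tuple.sort x).toEmbedding]
  refine Finset.card_le_card fun i hi => ?_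
  have hi' := (Finset.mem_filter.mp hi).2
  refine Finset.mem_map.mpr ⟨(Tuple.sort x).symm i, Finset.mem_Iio.mpr ?_, by simp⟩
  by_contra hle
  have := Tuple.monotone_sort x (not_lt.mp hle)
  simp only [Function.comp_apply, Equiv.apply_symm_apply] at this
  exact absurd (h.trans_le (this.trans hi')) (lt_irrefl _)

/-- The point `a / q` of the unit interval. -/
noncomputable def gridPoint (q : ℕ) (a : Fin (q + 1)) : unitInterval :=
  ⟨(a : ℕ) / q, by positivity, div_le_one_of_le₀ (by exact_mod_cast Nat.lt_succ_iff.mp a.2)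
    (Nat.cast_nonneg q)⟩

/-- If the empirical distribution function of `x` is close to the identity, then so is the map that
sends a point of the `k`-th pixel to the `k`-th order statistic of `x`. -/
theorem abs_sub_sort_pixelIndex_le {n q : ℕ} (hn : 1 ≤ n) (hq : 1 ≤ q) (x : Fin n → unitInterval)
    (h : ∀ a : Fin (q + 1), |((Finset.univ.filter fun i => x i ≤ gridPoint q a).card : ℝ)
      - n * gridPoint q a| < 1 / q * n) (t : unitInterval) :
    |(t : ℝ) - x (Tuple.sort x (pixelIndex hn t))| ≤ 2 / q := by
  have hn' : (0 : ℝ) < n := by exact_mod_cast hn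
  have hq' : (0 : ℝ) < q := by exact_mod_cast hq
  obtain ⟨ht1, ht2⟩ := abs_sub_pixelIndex_le hn t
  set k := pixelIndex hn t
  set v := x (Tuple.sort x k) with hv
  have hv0 : 0 ≤ (v : ℝ) := v.2.1
  have hv1 : (v : ℝ) ≤ 1 := v.2.2
  have hceil : ⌈(q : ℝ) * v⌉₊ ≤ q := Nat.ceil_le.mpr (by nlinarith)
  have hlt := Nat.ceil_lt_add_one (mul_nonneg hq'.le hv0)
  have hle := Nat.le_ceil ((q : ℝ) * v)
  rw [abs_le]
  constructor
  -- If `v = 0` no grid point lies below it and the bound is trivial. Otherwise use the largest grid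
  -- point strictly below `v`; rounding and the empirical deviation each cost `1 / q`.
  · rcases Nat.eq_zero_or_pos ⌈(q : ℝ) * v⌉₊ with h0 | hpos
    · rw [h0, Nat.cast_zero] at hle
      have : (v : ℝ) ≤ 0 := by nlinarith
      have h2 : (0 : ℝ) ≤ 2 / q := by positivity
      linarith [t.2.1]
    · set a : Fin (q + 1) := ⟨⌈(q : ℝ) * v⌉₊ - 1, by omega⟩ with ha
      have hav : ((a : ℕ) : ℝ) = (⌈(q : ℝ) * v⌉₊ : ℝ) - 1 := by
        simp only [ha]
        rw [Nat.cast_sub hpos, Nat.cast_one]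
      have hgv : (gridPoint q a : ℝ) = ((⌈(q : ℝ) * v⌉₊ : ℝ) - 1) / q := by
        rw [← hav]
        rfl
      have hlt' : gridPoint q a < v := by
        rw [← Subtype.coe_lt_coe, hgv, div_lt_iff₀ hq']
        linarith
      have h1 : (((Finset.univ.filter fun i => x i ≤ gridPoint q a).card : ℕ) : ℝ) ≤ (k : ℕ) := by
        exact_mod_cast card_filter_le_of_lt_sort x k hlt'
      have h2 := (abs_lt.mp (h a)).1
      rw [hgv] at h2
      have h3 : (n : ℝ) * (v - 2 / q) ≤ (k : ℕ) := by
        have h4 : (v : ℝ) ≤ (⌈(q : ℝ) * v⌉₊ : ℝ) / q := by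
          rw [le_div_iff₀ hq']
          linarith
        have h5 : (n : ℝ) * v ≤ n * ((⌈(q : ℝ) * v⌉₊ : ℝ) / q) := by gcongr
        rw [sub_div] at h2
        have h6 : (2 : ℝ) / q = 1 / q + 1 / q := by ring
        rw [h6]
        linarith
      have h4 : (v : ℝ) - 2 / q ≤ ((k : ℕ) : ℝ) / n := by
        rw [le_div_iff₀ hn']
        linarith
      linarith
  -- Here the smallest grid point at or above `v` is used.
  · set a : Fin (q + 1) := ⟨⌈(q : ℝ) * v⌉₊, by omega⟩ with ha
    have hgv : (gridPoint q a : ℝ) = (⌈(q : ℝ) * v⌉₊ : ℝ) / q := rfl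
    have hle' : v ≤ gridPoint q a := by
      rw [← Subtype.coe_le_coe, hgv, le_div_iff₀ hq']
      linarith
    have h1 : ((k : ℕ) : ℝ) + 1 ≤ ((Finset.univ.filter fun i => x i ≤ gridPoint q a).card : ℕ) := by
      exact_mod_cast le_card_filter_of_le_sort x k hle'
    have h2 := (abs_lt.mp (h a)).2
    rw [hgv] at h2
    have h3 : ((k : ℕ) : ℝ) + 1 ≤ n * (v + 2 / q) := by
      have h4 : (⌈(q : ℝ) * v⌉₊ : ℝ) / q ≤ v + 1 / q := by
        rw [div_le_iff₀ hq', add_mul, div_mul_cancel₀ _ hq'.ne']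
        linarith
      have h5 : (n : ℝ) * ((⌈(q : ℝ) * v⌉₊ : ℝ) / q) ≤ n * (v + 1 / q) := by gcongr
      have h6 : (2 : ℝ) / q = 1 / q + 1 / q := by ring
      rw [h6]
      linarith
    have h4 : (((k : ℕ) : ℝ) + 1) / n ≤ v + 2 / q := by
      rw [div_le_iff₀ hn']
      linarith
    linarith

end Sorting

/-! ### Summable tail bounds. -/

section Summability

theorem tsum_ofReal_mul_exp_ne_top (C : ℝ) {c : ℝ} (hc : 0 < c) :
    ∑' n : ℕ, ENNReal.ofReal (C * Real.exp (-c * n)) ≠ ⊤ := by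
  have h : Summable fun n : ℕ => C * Real.exp (-c * n) := by
    refine Summable.mul_left C ?_
    simpa [mul_comm] using Real.summable_exp_nat_mul_iff.mpr (neg_lt_zero.mpr hc)
  exact h.tsum_ofReal_ne_top

/-- Quadratic decay beats the number of vertex-set products: bound 2 by `e` and complete the square
in `(m + 1) * n - c * n ^ 2`, the extra `n` leaving a geometric factor. -/
theorem two_pow_mul_exp_neg_sq_le (m n : ℕ) {c : ℝ} (hc : 0 < c) :
    ((2 : ℝ) ^ n) ^ m * Real.exp (-c * n ^ 2)
      ≤ Real.exp ((m + 1) ^ 2 / (4 * c)) * Real.exp (-1 * n) := by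
  have h2 : ((2 : ℝ) ^ n) ^ m ≤ Real.exp (n * m) := by
    rw [← pow_mul, ← Nat.cast_mul, ← Real.exp_one_pow]
    have : (2 : ℝ) ≤ Real.exp 1 := by linarith [Real.add_one_le_exp (1 : ℝ)]
    gcongr
  calc ((2 : ℝ) ^ n) ^ m * Real.exp (-c * n ^ 2)
      ≤ Real.exp (n * m) * Real.exp (-c * n ^ 2) := by gcongr
    _ ≤ _ := by
        rw [← Real.exp_add, ← Real.exp_add, Real.exp_le_exp]
        have h3 : 0 ≤ ((m + 1 : ℝ) - 2 * c * n) ^ 2 / (4 * c) := by positivity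
        have h4 : ((m + 1 : ℝ) - 2 * c * n) ^ 2 / (4 * c)
            = (m + 1 : ℝ) ^ 2 / (4 * c) - (m + 1) * n + c * n ^ 2 := by
          field_simp
          ring
        rw [h4] at h3
        linarith

end Summability

/-! ### Continuous approximation. -/

section Approximation

theorem exists_continuous_integral_abs_sub_le {m : ℕ} (H : (Fin m → unitInterval) → ℝ)
    (hH : Measurable H) (h0 : ∀ y, 0 ≤ H y) (h1 : ∀ y, H y ≤ 1) {ε : ℝ} (hε : 0 < ε) :
    ∃ g : (Fin m → unitInterval) → ℝ, Continuous g ∧ (∀ y, 0 ≤ g y) ∧ (∀ y, g y ≤ 1) ∧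
      ∫ y, |H y - g y| ≤ ε := by
  have hi : Integrable H := Integrable.of_bound hH.aestronglyMeasurable 1 (ae_of_all _ fun y => by
    rw [Real.norm_eq_abs, abs_of_nonneg (h0 y)]
    exact h1 y)
  obtain ⟨f, hf, hfi⟩ := hi.exists_boundedContinuous_integral_sub_le hε
  -- Clamping to `[0,1]` is 1-Lipschitz and fixes the values of `H`, so it does not worsen the
  -- approximation.
  have hg : Continuous fun y => max 0 (min 1 (f y)) :=
    continuous_const.max (continuous_const.min f.continuous)
  refine ⟨fun y => max 0 (min 1 (f y)), hg, fun y => le_max_left _ _,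
    fun y => max_le zero_le_one (min_le_left _ _), le_trans ?_ hf⟩
  refine integral_mono_of_nonneg (ae_of_all _ fun y => abs_nonneg _) (hi.sub hfi).norm
    (ae_of_all _ fun y => ?_)
  change |H y - max 0 (min 1 (f y))| ≤ |H y - f y|
  have hc : H y = max 0 (min 1 (H y)) := by
    rw [min_eq_right (h1 y), max_eq_right (h0 y)]
  calc |H y - max 0 (min 1 (f y))| = |max 0 (min 1 (H y)) - max 0 (min 1 (f y))| := by rw [← hc]
    _ ≤ |min 1 (H y) - min 1 (f y)| := by
        simpa using abs_max_sub_max_le_max 0 (min 1 (H y)) 0 (min 1 (f y))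
    _ ≤ |H y - f y| := by
        simpa using abs_min_sub_min_le_max 1 (H y) 1 (f y)

theorem exists_nat_forall_abs_sub_le {m : ℕ} {g : (Fin m → unitInterval) → ℝ} (hg : Continuous g)
    {ε : ℝ} (hε : 0 < ε) : ∃ q : ℕ, 1 ≤ q ∧ ∀ y z : Fin m → unitInterval,
      (∀ l, |(y l : ℝ) - z l| ≤ 2 / q) → |g y - g z| ≤ ε := by
  have hu := CompactSpace.uniformContinuous_of_continuous hg
  obtain ⟨δ, hδ, h⟩ := Metric.uniformContinuous_iff.mp hu ε hε
  obtain ⟨q, hq⟩ := exists_nat_gt (2 / δ)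
  have hq0 : (0 : ℝ) < q := lt_trans (by positivity) hq
  refine ⟨q, by exact_mod_cast hq0, fun y z hyz => ?_⟩
  have hd : dist y z < δ := by
    refine (dist_pi_lt_iff hδ).mpr fun l => lt_of_le_of_lt (hyz l) ?_
    rw [div_lt_iff₀ hδ] at hq
    rw [div_lt_iff₀ hq0]
    linarith
  exact (h hd).le

end Approximation

/-! ### Exceptional events with summable measures. -/

section Concentration

theorem volume_fst_preimage {X Y : Type*} [MeasureSpace X] [MeasureSpace Y]
    [IsProbabilityMeasure (volume : Measure X)] [IsProbabilityMeasure (volume : Measure Y)]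
    (A : Set X) : volume ((Prod.fst : X × Y → X) ⁻¹' A) = volume A := by
  rw [← Set.prod_univ, Measure.volume_eq_prod, Measure.prod_prod, measure_univ, mul_one]

/-- For each family `S`, Fubini reduces to coin concentration with `x` fixed; then a union bound
over the `(2 ^ n) ^ m` families. -/
theorem Complexon.volume_iUnion_abs_sum_coinInd_sub_le (W : Complexon) {m n : ℕ} (hm : 1 ≤ m)
    (hn : 1 ≤ n) {ε : ℝ} (hε : 0 ≤ ε) :
    volume (⋃ S : Fin m → Finset (Fin n),
      {p : (Fin n → unitInterval) × (Finset (Fin n) → unitInterval) | ε * (n : ℝ) ^ m ≤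
        |∑ k ∈ (injTuples m n).filter (fun k => ∀ l, k l ∈ S l),
          (coinInd (fun σ => W.onFace p.1 σ) p.2 (Finset.univ.image k)
            - (W.faceted.toFun m (p.1 ∘ k) : ℝ))|})
      ≤ ENNReal.ofReal (((2 : ℝ) ^ n) ^ m
          * (2 * Real.exp (-(2 * ε ^ 2 / (m ^ 2 * 2 ^ m)) * n ^ 2))) := by
  have hS : ∀ S : Fin m → Finset (Fin n), volume
      {p : (Fin n → unitInterval) × (Finset (Fin n) → unitInterval) | ε * (n : ℝ) ^ m ≤
        |∑ k ∈ (injTuples m n).filter (fun k => ∀ l, k l ∈ S l),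
          (coinInd (fun σ => W.onFace p.1 σ) p.2 (Finset.univ.image k)
            - (W.faceted.toFun m (p.1 ∘ k) : ℝ))|}
      ≤ ENNReal.ofReal (2 * Real.exp (-(2 * ε ^ 2 / (m ^ 2 * 2 ^ m)) * n ^ 2)) := by
    intro S
    have hmeas : Measurable fun p : (Fin n → unitInterval) × (Finset (Fin n) → unitInterval) =>
        |∑ k ∈ (injTuples m n).filter (fun k => ∀ l, k l ∈ S l),
          (coinInd (fun σ => W.onFace p.1 σ) p.2 (Finset.univ.image k)
            - (W.faceted.toFun m (p.1 ∘ k) : ℝ))| := by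
      refine (Finset.measurable_sum _ fun k _ => Measurable.sub ?_ ?_).abs
      · exact measurable_coinInd_of_measurable
          (X := (Fin n → unitInterval) × (Finset (Fin n) → unitInterval))
          (β := fun p σ => W.onFace p.1 σ) (u := fun p => p.2)
          (fun τ => (W.measurable_onFace τ).comp measurable_fst)
          (fun τ => (measurable_pi_apply τ).comp measurable_snd) _
      · have hk : Measurable fun x : Fin n → unitInterval => x ∘ k :=
          measurable_pi_lambda _ fun i => measurable_pi_apply _
        exact measurable_subtype_coe.comp
          ((W.faceted.measurable_toFun m).comp (hk.comp measurable_fst))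
    rw [Measure.volume_eq_prod, Measure.prod_apply (measurableSet_le measurable_const hmeas)]
    refine (lintegral_mono (g := fun _ => ENNReal.ofReal
      (2 * Real.exp (-(2 * ε ^ 2 / (m ^ 2 * 2 ^ m)) * n ^ 2))) fun x => ?_).trans (by simp)
    refine le_trans (le_of_eq ?_) (measure_abs_sum_coinInd_sub_le hm hn (fun σ => W.onFace x σ)
      ((injTuples m n).filter (fun k => ∀ l, k l ∈ S l)) hε)
    congr 1
    ext u
    simp only [Set.mem_preimage, Set.mem_ofPred_eq]
    rw [Finset.sum_congr rfl fun k hk => by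
      rw [W.faceted_comp_of_injective x (mem_injTuples.mp (Finset.mem_filter.mp hk).1)]]
  refine (measure_iUnion_fintype_le _ _).trans ((Finset.sum_le_sum fun S _ => hS S).trans ?_)
  rw [Finset.sum_const, nsmul_eq_mul, ENNReal.ofReal_mul (p := ((2 : ℝ) ^ n) ^ m) (by positivity)]
  refine le_of_eq ?_
  congr 1
  rw [Finset.card_univ, Fintype.card_pi, Finset.prod_const, Fintype.card_finset, Finset.card_univ,
    Fintype.card_fin, Fintype.card_fin, ← ENNReal.ofReal_natCast]
  push_cast
  rfl

/-- In each dimension, the labeled cut distance of the faceted complexon and the sampled complex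
with sorted sample points is small outside of events of summable measures. -/
theorem Complexon.exists_summable_cutDist_le (W : Complexon) {j : ℕ} (hj : 1 ≤ j) {ε : ℝ}
    (hε : 0 < ε) :
    ∃ b : ∀ n : ℕ, Set ((Fin n → unitInterval) × (Finset (Fin n) → unitInterval)),
      ∑' n, volume (b n) ≠ ⊤ ∧ ∀ (n : ℕ) (hn : 1 ≤ n), ∀ p ∉ b n,
        Complexon.cutDist j W.faceted ((Complexon.ofComplex (W.sample n p)).pullback
          (pixelExchange hn (Tuple.sort p.1)) (measurable_pixelExchange hn _)) ≤ 6 * ε := by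
  classical
  set m := j + 1 with hm
  have hm1 : 1 ≤ m := by omega
  have hm2 : 2 ≤ m := by omega
  have hm' : (0 : ℝ) < m := by exact_mod_cast hm1
  set H : (Fin m → unitInterval) → ℝ := fun y => (W.faceted.toFun m y : ℝ) with hH
  have hHm : Measurable H := measurable_subtype_coe.comp (W.faceted.measurable_toFun m)
  have hH0 : ∀ y, 0 ≤ H y := fun y => (W.faceted.toFun m y).2.1
  have hH1 : ∀ y, H y ≤ 1 := fun y => (W.faceted.toFun m y).2.2
  obtain ⟨g, hg, hg0, hg1, hgε⟩ := exists_continuous_integral_abs_sub_le H hHm hH0 hH1 hε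
  obtain ⟨q, hq, hgq⟩ := exists_nat_forall_abs_sub_le hg hε
  obtain ⟨n₀, hn₀⟩ := exists_nat_gt ((m : ℝ) ^ 2 / ε)
  have hq' : (0 : ℝ) < q := by exact_mod_cast hq
  have hD0 : ∀ y, 0 ≤ |H y - g y| := fun y => abs_nonneg _
  have hD1 : ∀ y, |H y - g y| ≤ 1 := fun y => abs_le.mpr
    ⟨by linarith [hH0 y, hg1 y], by linarith [hH1 y, hg0 y]⟩
  have hDm : Measurable fun y => |H y - g y| := (hHm.sub hg.measurable).abs
  set c₁ : ℝ := 2 * (1 / q) ^ 2 with hc₁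
  set c₂ : ℝ := 2 * ε ^ 2 / m ^ 2 with hc₂
  set c₃ : ℝ := 2 * ε ^ 2 / (m ^ 2 * 2 ^ m) with hc₃
  have hc₁' : 0 < c₁ := by positivity
  have hc₂' : 0 < c₂ := by positivity
  have hc₃' : 0 < c₃ := by positivity
  -- The failures are: a bad empirical distribution at some grid point, a large U-statistic of `|H -
  -- g|`, or a large coin error for some `S`. Small `n`, where `m ^ 2 / n` may exceed `ε`, are
  -- discarded outright at finite total cost.
  let B₁ : ∀ n : ℕ, Set (Fin n → unitInterval) := fun n => ⋃ a : Fin (q + 1),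
    {x | 1 / q * n ≤ |((Finset.univ.filter fun i => x i ≤ gridPoint q a).card : ℝ)
      - n * gridPoint q a|}
  let B₂ : ∀ n : ℕ, Set (Fin n → unitInterval) := fun n => {x | ε * (n : ℝ) ^ m ≤
    |∑ k ∈ injTuples m n, |H (x ∘ k) - g (x ∘ k)| - (injTuples m n).card * (∫ y, |H y - g y|)|}
  let B₃ : ∀ n : ℕ, Set ((Fin n → unitInterval) × (Finset (Fin n) → unitInterval)) := fun n =>
    ⋃ S : Fin m → Finset (Fin n), {p | ε * (n : ℝ) ^ m ≤
        |∑ k ∈ (injTuples m n).filter (fun k => ∀ l, k l ∈ S l),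
          (coinInd (fun σ => W.onFace p.1 σ) p.2 (Finset.univ.image k) - H (p.1 ∘ k))|}
  let b : ∀ n : ℕ, Set ((Fin n → unitInterval) × (Finset (Fin n) → unitInterval)) := fun n =>
    if n < n₀ + 1 then Set.univ else Prod.fst ⁻¹' B₁ n ∪ Prod.fst ⁻¹' B₂ n ∪ B₃ n
  refine ⟨b, ?_, ?_⟩
  · set e₀ : ℕ → ENNReal := fun n => if n < n₀ + 1 then 1 else 0
    set e₁ : ℕ → ENNReal := fun n => ENNReal.ofReal (((q + 1 : ℕ) * 2) * Real.exp (-c₁ * n))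
    set e₂ : ℕ → ENNReal := fun n => ENNReal.ofReal (2 * Real.exp (-c₂ * n))
    set e₃ : ℕ → ENNReal := fun n =>
      ENNReal.ofReal ((2 * Real.exp ((m + 1) ^ 2 / (4 * c₃))) * Real.exp (-1 * n))
    have hle : ∀ n, volume (b n) ≤ e₀ n + (e₁ n + (e₂ n + e₃ n)) := by
      intro n
      by_cases hn : n < n₀ + 1
      · simp only [b, e₀, if_pos hn, measure_univ]
        exact le_self_add
      · have hn1 : 1 ≤ n := by omega
        simp only [b, e₀, if_neg hn, zero_add]
        have h1 : volume ((Prod.fst : (Fin n → unitInterval) × (Finset (Fin n) → unitInterval) → _)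
            ⁻¹' B₁ n) ≤ e₁ n := by
          rw [volume_fst_preimage]
          refine (measure_iUnion_fintype_le _ _).trans ((Finset.sum_le_sum fun a _ =>
            measure_abs_card_le_sub_le hn1 (gridPoint q a)
              (ε := 1 / q) (by positivity)).trans (le_of_eq ?_))
          rw [Finset.sum_const, Finset.card_univ, Fintype.card_fin, nsmul_eq_mul,
            ← ENNReal.ofReal_natCast, ← ENNReal.ofReal_mul (by positivity), ← mul_assoc]
        have h2 : volume ((Prod.fst : (Fin n → unitInterval) × (Finset (Fin n) → unitInterval) → _)
            ⁻¹' B₂ n) ≤ e₂ n := by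
          rw [volume_fst_preimage]
          exact measure_abs_sum_injTuples_sub_le hm1 hn1 _ hDm hD0 hD1 hε.le
        have h3 : volume (B₃ n) ≤ e₃ n := by
          refine (W.volume_iUnion_abs_sum_coinInd_sub_le hm1 hn1 hε.le).trans
            (ENNReal.ofReal_le_ofReal ?_)
          have := two_pow_mul_exp_neg_sq_le m n hc₃'
          linarith
        refine (measure_union_le _ _).trans ?_
        rw [← add_assoc]
        exact add_le_add ((measure_union_le _ _).trans (add_le_add h1 h2)) h3
    refine ne_top_of_le_ne_top ?_ (ENNReal.tsum_le_tsum hle)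
    rw [ENNReal.tsum_add, ENNReal.tsum_add, ENNReal.tsum_add]
    have h0 : ∑' n, e₀ n ≠ ⊤ := by
      rw [tsum_eq_sum (s := Finset.range (n₀ + 1)) fun n hn => if_neg (by simpa using hn)]
      exact ENNReal.sum_ne_top.mpr fun n _ => by
        change (if n < n₀ + 1 then (1 : ENNReal) else 0) ≠ ⊤
        split_ifs <;> simp
    exact ENNReal.add_ne_top.mpr ⟨h0, ENNReal.add_ne_top.mpr
      ⟨tsum_ofReal_mul_exp_ne_top _ hc₁', ENNReal.add_ne_top.mpr
        ⟨tsum_ofReal_mul_exp_ne_top _ hc₂', tsum_ofReal_mul_exp_ne_top _ one_pos⟩⟩⟩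
  · rintro n hn ⟨x, u⟩ hp
    have hn' : (0 : ℝ) < n := by exact_mod_cast hn
    have hlt : ¬ n < n₀ + 1 := fun h => hp (by simp only [b, if_pos h, Set.mem_univ])
    simp only [b, if_neg hlt, Set.mem_union, Set.mem_preimage, not_or] at hp
    obtain ⟨⟨h1, h2⟩, h3⟩ := hp
    simp only [B₁, Set.mem_iUnion, Set.mem_ofPred_eq, not_exists, not_le] at h1
    simp only [B₂, Set.mem_ofPred_eq, not_le] at h2
    simp only [B₃, Set.mem_iUnion, Set.mem_ofPred_eq, not_exists, not_le] at h3
    have hsmall : (m : ℝ) ^ 2 / n ≤ ε := by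
      have : (n₀ : ℝ) ≤ n := by exact_mod_cast (by omega : n₀ ≤ n)
      rw [div_le_iff₀ hn']
      rw [div_lt_iff₀ hε] at hn₀
      nlinarith
    have hU : (∑ k ∈ injTuples m n, |H (x ∘ k) - g (x ∘ k)|) / (n : ℝ) ^ m ≤ 2 * ε := by
      rw [div_le_iff₀ (by positivity)]
      have h4 := (abs_lt.mp h2).2
      have h5 : ((injTuples m n).card : ℝ) * ∫ y, |H y - g y| ≤ (n : ℝ) ^ m * ε :=
        mul_le_mul (card_injTuples_le m n) hgε (integral_nonneg hD0) (by positivity)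
      linarith
    refine Real.iSup_le (fun S => ?_) (by positivity)
    refine (W.abs_setIntegral_faceted_sub_le hm2 hn x u (Tuple.sort x) g hg.measurable hg0 hg1
      (η := ε) (C := ε) (fun y => hgq _ _ fun l => abs_sub_sort_pixelIndex_le hn hq x h1 (y l))
      (fun S => (h3 S).le) S.1).trans ?_
    -- The five terms are at most `ε`, `ε`, `2 * ε`, `ε` and `ε`.
    change (∫ y, |H y - g y|) + ε + (∑ k ∈ injTuples m n, |H (x ∘ k) - g (x ∘ k)|) / (n : ℝ) ^ m
      + m ^ 2 / n + ε ≤ 6 * ε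
    linarith

end Concentration

/-! ### From summability to almost sure convergence. -/

section Convergence

theorem Complexon.cutDist_nonneg (j : ℕ) (U V : Complexon) : 0 ≤ Complexon.cutDist j U V :=
  Real.iSup_nonneg fun _ => abs_nonneg _

theorem Complexon.labeledCutDist_nonneg {d : ℕ} {α : Fin d → ℝ} (hα : ∀ j, 0 ≤ α j)
    (U V : Complexon) : 0 ≤ Complexon.labeledCutDist α U V :=
  Finset.sum_nonneg fun j _ => mul_nonneg (hα j) (Complexon.cutDist_nonneg _ U V)

theorem Complexon.unlabeledCutDist_nonneg {d : ℕ} {α : Fin d → ℝ} (hα : ∀ j, 0 ≤ α j)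
    (U V : Complexon) : 0 ≤ Complexon.unlabeledCutDist α U V :=
  Real.iInf_nonneg fun _ => Complexon.labeledCutDist_nonneg hα _ _

theorem Complexon.unlabeledCutDist_le {d : ℕ} {α : Fin d → ℝ} (hα : ∀ j, 0 ≤ α j)
    (U V : Complexon) {φ : unitInterval → unitInterval} (hφ : MeasurePreserving φ volume volume) :
    Complexon.unlabeledCutDist α U V ≤ Complexon.labeledCutDist α U (V.pullback φ hφ.measurable) :=
  ciInf_le (f := fun φ : {φ : unitInterval → unitInterval // MeasurePreserving φ volume volume} =>
      Complexon.labeledCutDist α U (V.pullback φ.1 φ.2.measurable))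
    ⟨0, by rintro _ ⟨ψ, rfl⟩; exact Complexon.labeledCutDist_nonneg hα _ _⟩ ⟨φ, hφ⟩

theorem Complexon.tsum_sampleLaw_unlabeledCutDist_ne_top (W : Complexon) {d : ℕ} (α : Fin d → ℝ)
    (hα : ∀ j, 0 ≤ α j) {ε : ℝ} (hε : 0 < ε) :
    ∑' n, (if 1 ≤ n then W.sampleLaw n
      {K | ε < Complexon.unlabeledCutDist α W.faceted (Complexon.ofComplex K)} else 0) ≠ ⊤ := by
  -- The added 1 keeps the denominator positive when all weights vanish.
  set A : ℝ := 1 + ∑ j, α j with hA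
  have hA0 : 0 < A := add_pos_of_pos_of_nonneg one_pos (Finset.sum_nonneg fun j _ => hα j)
  set ε' : ℝ := ε / (6 * A) with hε'
  have hε'0 : 0 < ε' := by positivity
  choose b hb hbound using fun j : Fin d =>
    W.exists_summable_cutDist_le (j := (j : ℕ) + 1) (Nat.le_add_left _ _) hε'0
  have hle : ∀ n, (if 1 ≤ n then W.sampleLaw n
      {K | ε < Complexon.unlabeledCutDist α W.faceted (Complexon.ofComplex K)} else 0)
      ≤ ∑ j, volume (b j n) := by
    intro n
    split_ifs with hn
    · rw [Complexon.sampleLaw, Measure.map_apply (W.measurable_sample n) trivial]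
      refine (measure_mono ?_).trans (measure_iUnion_fintype_le _ fun j => b j n)
      intro p hp
      by_contra hnot
      simp only [Set.mem_iUnion, not_exists] at hnot
      rw [Set.mem_preimage, Set.mem_ofPred_eq] at hp
      refine absurd hp (not_lt.mpr ?_)
      -- The sorting permutation depends only on the sample points, so one map is admissible for all
      -- dimensions at once.
      refine (Complexon.unlabeledCutDist_le hα _ _
        (measurePreserving_pixelExchange hn (Tuple.sort p.1))).trans ?_
      calc Complexon.labeledCutDist α W.faceted _
          ≤ ∑ j, α j * (6 * ε') := Finset.sum_le_sum fun j _ =>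
            mul_le_mul_of_nonneg_left (hbound j n hn p (hnot j)) (hα j)
        _ = (A - 1) * (6 * ε') := by rw [← Finset.sum_mul, hA]; ring
        _ ≤ A * (6 * ε') := by
            refine mul_le_mul_of_nonneg_right ?_ (by positivity)
            linarith
        _ = ε := by
            rw [hε']
            field_simp
    · exact zero_le
  refine ne_top_of_le_ne_top ?_ (ENNReal.tsum_le_tsum hle)
  rw [Summable.tsum_finsetSum fun _ _ => ENNReal.summable]
  exact ENNReal.sum_ne_top.mpr fun j _ => hb j

end Convergence

theorem mainTheorem6 (W : Complexon) {d : ℕ} (α : Fin d → ℝ) (hα : ∀ j, 0 ≤ α j)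
    {Ω : Type*} [MeasurableSpace Ω] (P : Measure Ω) [IsProbabilityMeasure P]
    (K : (n : ℕ) → Ω → AbstractSimplicialComplex (Fin n))
    (hK : ∀ n, 1 ≤ n → HasLaw (K n) (W.sampleLaw n) P) :
    ∀ᵐ ω ∂P, Tendsto
      (fun n => Complexon.unlabeledCutDist α W.faceted (Complexon.ofComplex (K n ω)))
      atTop (𝓝 0) := by
  have hev : ∀ i : ℕ, ∀ᵐ ω ∂P, ∀ᶠ n in atTop,
      ω ∉ {ω | 1 ≤ n ∧ 1 / ((i : ℝ) + 1) <
        Complexon.unlabeledCutDist α W.faceted (Complexon.ofComplex (K n ω))} := by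
    intro i
    -- Borel–Cantelli for each threshold `1 / (i + 1)`; countably many thresholds are then
    -- intersected.
    refine ae_eventually_notMem (ne_top_of_le_ne_top
      (W.tsum_sampleLaw_unlabeledCutDist_ne_top α hα (Nat.one_div_pos_of_nat (n := i)))
      (ENNReal.tsum_le_tsum fun n => ?_))
    split_ifs with hn
    · rw [← (hK n hn).map_eq, Measure.map_apply_of_aemeasurable (hK n hn).aemeasurable trivial]
      exact measure_mono fun ω hω => hω.2
    · simp [hn]
  filter_upwards [ae_all_iff.mpr hev] with ω hω
  rw [Metric.tendsto_atTop]
  intro ε hε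
  obtain ⟨i, hi⟩ := exists_nat_one_div_lt hε
  obtain ⟨N, hN⟩ := eventually_atTop.mp (hω i)
  refine ⟨max N 1, fun n hn => ?_⟩
  have h1 := hN n ((le_max_left _ _).trans hn)
  simp only [not_and, not_lt] at h1
  rw [Real.dist_eq, sub_zero, abs_of_nonneg (Complexon.unlabeledCutDist_nonneg hα _ _)]
  exact (h1 ((le_max_right _ _).trans hn)).trans_lt hi
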